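/- Let $n\ge 1$. For $s,\sigma\in\mathbb R$ let $H^s_\sigma=H^s_\sigma(\mathbb R^n)$ be the weighted Sobolev space of tempered distributions $\psi$ on $\mathbb R^n$ with finite norm $$\|\psi\|_{H^s_\sigma}=\|\langle x\rangle^\sigma\langle\nabla\rangle^s\psi\|_{L^2(\mathbb R^n)},\qquad \langle x\rangle=(1+|x|^2)^{1/2},\quad \langle\nabla\rangle=(1-\Delta)^{1/2}.$$ For $\zeta\in\mathbb C\setminus[0,\infty)$ let $R_0(\zeta)=(-\Delta-\zeta)^{-1}$ be the resolvent of the free Schrödinger operator, acting on tempered distributions. Let $k\in\{0,1,2,\dots\}$, $\sigma>\tfrac12+k$, $s\in\mathbb R$, and let $l\in\{-1,0,1,2\}$ if $k=0$, and $l\in\{-1,0,1\}$ if $k\ge1$. Then for every $\zeta\in\mathbb C\setminus[0,\infty)$ the operator $R_0(\zeta)$ restricts to a bounded operator from $H^s_\sigma$ to $H^{s+l}_{-\sigma}$, it is an analytic function of $\zeta\in\mathbb C\setminus[0,\infty)$ with values in the space $\mathcal L(H^s_\sigma,H^{s+l}_{-\sigma})$ of bounded linear operators, with the operator norm, and its $k$-th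 derivative $R_0^{(k)}(\zeta)$ with respect to $\zeta$ satisfies $$\|R_0^{(k)}(\zeta)\|_{\mathcal L(H^s_\sigma,H^{s+l}_{-\sigma})}=\mathcal O\big(|\zeta|^{-\frac{1-l+k}{2}}\big),\qquad |\zeta|\to\infty,\quad \zeta\in\mathbb C\setminus[0,\infty).$$ -/

import Mathlib

open MeasureTheory Filter Topology
open scoped SchwartzMap Real

noncomputable section

namespace WeightedSobolev

/-- Euclidean space `ℝⁿ`. -/
abbrev Rn (n : ℕ) : Type := EuclideanSpace ℝ (Fin n)

/-- Multiplication of tempered distributions by `⟨x⟩^σ`, where `⟨x⟩ = (1 + |x|²)^{1/2}`. -/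
def weight (n : ℕ) (σ : ℝ) : 𝓢'(Rn n, ℂ) →L[ℂ] 𝓢'(Rn n, ℂ) :=
  TemperedDistribution.smulLeftCLM ℂ (fun x : Rn n ↦ (((1 + ‖x‖ ^ 2) ^ (σ / 2) : ℝ) : ℂ))

/-- The operator `⟨∇⟩^s = (1 - Δ)^{s/2}` on tempered distributions. Since the Fourier transform
of Mathlib has the kernel `exp (-2πi x·ξ)`, its symbol is `(1 + |2πξ|²)^{s/2}`. -/
def japaneseNabla (n : ℕ) (s : ℝ) : 𝓢'(Rn n, ℂ) →L[ℂ] 𝓢'(Rn n, ℂ) :=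
  TemperedDistribution.fourierMultiplierCLM ℂ
    (fun ξ : Rn n ↦ (((1 + ‖(2 * π) • ξ‖ ^ 2) ^ (s / 2) : ℝ) : ℂ))

theorem hasTemperateGrowth_weight (n : ℕ) (σ : ℝ) :
    (fun x : Rn n ↦ (((1 + ‖x‖ ^ 2) ^ (σ / 2) : ℝ) : ℂ)).HasTemperateGrowth := by
  fun_prop

theorem hasTemperateGrowth_japanese (n : ℕ) (s : ℝ) :
    (fun ξ : Rn n ↦ (((1 + ‖(2 * π) • ξ‖ ^ 2) ^ (s / 2) : ℝ) : ℂ)).HasTemperateGrowth :=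
  (hasTemperateGrowth_weight n s).comp
    (((2 * π) • ContinuousLinearMap.id ℝ (Rn n)).hasTemperateGrowth)

theorem weight_neg_weight (n : ℕ) (σ : ℝ) (u : 𝓢'(Rn n, ℂ)) :
    weight n (-σ) (weight n σ u) = u := by
  rw [weight, weight, TemperedDistribution.smulLeftCLM_smulLeftCLM_apply
    (hasTemperateGrowth_weight n _) (hasTemperateGrowth_weight n _)]
  convert TemperedDistribution.smulLeftCLM_const (1 : ℂ) u using 2
  · congr 1
    ext x
    simp only [Pi.mul_apply]
    rw [← Complex.ofReal_mul, ← Real.rpow_add (by positivity)]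
    simp [neg_div]
  · simp

theorem japaneseNabla_neg_japaneseNabla (n : ℕ) (s : ℝ) (u : 𝓢'(Rn n, ℂ)) :
    japaneseNabla n (-s) (japaneseNabla n s u) = u := by
  rw [japaneseNabla, japaneseNabla,
    TemperedDistribution.fourierMultiplierCLM_fourierMultiplierCLM_apply
    (hasTemperateGrowth_japanese n _) (hasTemperateGrowth_japanese n _)]
  have h : ((fun ξ : Rn n ↦ (((1 + ‖(2 * π) • ξ‖ ^ 2) ^ (s / 2) : ℝ) : ℂ)) *
      fun ξ : Rn n ↦ (((1 + ‖(2 * π) • ξ‖ ^ 2) ^ (-s / 2) : ℝ) : ℂ)) = fun _ ↦ (1 : ℂ) := by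
    ext x
    simp only [Pi.mul_apply]
    rw [← Complex.ofReal_mul, ← Real.rpow_add (by positivity)]
    simp [neg_div]
  rw [h]
  simp

/-- The weighted Sobolev space `H^s_σ(ℝⁿ)`: the tempered distributions `ψ` for which
`⟨x⟩^σ ⟨∇⟩^s ψ` belongs to `L²(ℝⁿ)`. -/
def Hs (n : ℕ) (s σ : ℝ) : Submodule ℂ 𝓢'(Rn n, ℂ) :=
  Submodule.comap (weight n σ ∘L japaneseNabla n s).toLinearMap
    (LinearMap.range
      (Lp.toTemperedDistributionCLM ℂ (volume : Measure (Rn n)) 2).toLinearMap)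

theorem mem_Hs_iff {n : ℕ} {s σ : ℝ} {ψ : 𝓢'(Rn n, ℂ)} :
    ψ ∈ Hs n s σ ↔ ∃ f : Lp ℂ 2 (volume : Measure (Rn n)),
      Lp.toTemperedDistributionCLM ℂ volume 2 f = weight n σ (japaneseNabla n s ψ) :=
  Iff.rfl

theorem toTempered_injective (n : ℕ) :
    Function.Injective (Lp.toTemperedDistributionCLM ℂ (volume : Measure (Rn n)) 2) :=
  LinearMap.ker_eq_bot.mp Lp.ker_toTemperedDistributionCLM_eq_bot

/-- The space `H^s_σ(ℝⁿ)` as a type of its own: it carries the topology of its norm, and not the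
one that it inherits from the tempered distributions. -/
def H (n : ℕ) (s σ : ℝ) : Type := Hs n s σ

instance (n : ℕ) (s σ : ℝ) : AddCommGroup (H n s σ) :=
  inferInstanceAs (AddCommGroup (Hs n s σ))

instance (n : ℕ) (s σ : ℝ) : Module ℂ (H n s σ) :=
  inferInstanceAs (Module ℂ (Hs n s σ))

/-- The tempered distribution underlying an element of `H^s_σ`. -/
def toDist (n : ℕ) (s σ : ℝ) : H n s σ →ₗ[ℂ] 𝓢'(Rn n, ℂ) := (Hs n s σ).subtype

theorem toDist_injective (n : ℕ) (s σ : ℝ) : Function.Injective (toDist n s σ) :=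
  Subtype.val_injective

/-- The `L²` function `⟨x⟩^σ ⟨∇⟩^s ψ` attached to `ψ ∈ H^s_σ`. -/
def toL2 (n : ℕ) (s σ : ℝ) : H n s σ →ₗ[ℂ] Lp ℂ 2 (volume : Measure (Rn n)) where
  toFun ψ := (mem_Hs_iff.mp ψ.2).choose
  map_add' ψ φ := toTempered_injective n <| by
    rw [map_add, (mem_Hs_iff.mp ψ.2).choose_spec, (mem_Hs_iff.mp φ.2).choose_spec,
      (mem_Hs_iff.mp (ψ + φ).2).choose_spec, ← map_add, ← map_add]
    rfl
  map_smul' c ψ := toTempered_injective n <| by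
    rw [map_smul, (mem_Hs_iff.mp ψ.2).choose_spec, (mem_Hs_iff.mp (c • ψ).2).choose_spec,
      RingHom.id_apply, ← map_smul, ← map_smul]
    rfl

theorem toL2_spec {n : ℕ} {s σ : ℝ} (ψ : H n s σ) :
    Lp.toTemperedDistributionCLM ℂ volume 2 (toL2 n s σ ψ) =
      weight n σ (japaneseNabla n s (toDist n s σ ψ)) :=
  (mem_Hs_iff.mp ψ.2).choose_spec

theorem toL2_injective (n : ℕ) (s σ : ℝ) : Function.Injective (toL2 n s σ) := by
  intro ψ φ h
  have h' := (toL2_spec ψ).symm.trans ((congrArg _ h).trans (toL2_spec φ))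
  apply toDist_injective
  rw [← japaneseNabla_neg_japaneseNabla n s (toDist n s σ ψ),
    ← weight_neg_weight n σ (japaneseNabla n s (toDist n s σ ψ)), h',
    weight_neg_weight, japaneseNabla_neg_japaneseNabla]

/-- The norm `‖ψ‖_{H^s_σ} = ‖⟨x⟩^σ ⟨∇⟩^s ψ‖_{L²}`. -/
instance (n : ℕ) (s σ : ℝ) : NormedAddCommGroup (H n s σ) :=
  NormedAddCommGroup.induced _ _ (toL2 n s σ) (toL2_injective n s σ)

instance (n : ℕ) (s σ : ℝ) : NormedSpace ℂ (H n s σ) :=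
  NormedSpace.induced ℂ _ _ (toL2 n s σ)

theorem norm_def {n : ℕ} {s σ : ℝ} (ψ : H n s σ) : ‖ψ‖ = ‖toL2 n s σ ψ‖ := rfl

/-- The operator `-Δ - ζ` on tempered distributions. -/
def schrodinger (n : ℕ) (ζ : ℂ) : 𝓢'(Rn n, ℂ) →L[ℂ] 𝓢'(Rn n, ℂ) :=
  -LineDeriv.laplacianCLM ℂ (Rn n) 𝓢'(Rn n, ℂ) - ζ • ContinuousLinearMap.id ℂ _

/-- The free resolvent `R₀(ζ) = (-Δ - ζ)⁻¹` on tempered distributions. By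
`schrodinger_freeResolvent` and `freeResolvent_schrodinger` it is the two-sided inverse of
`-Δ - ζ` whenever `ζ` is off the half-line `[0, ∞)`. -/
def freeResolvent (n : ℕ) (ζ : ℂ) : 𝓢'(Rn n, ℂ) →L[ℂ] 𝓢'(Rn n, ℂ) :=
  (schrodinger n ζ).inverse

/-- The slit plane `ℂ \ [0, ∞)`. -/
def slit : Set ℂ := ((fun x : ℝ ↦ (x : ℂ)) '' Set.Ici 0)ᶜ

theorem exists_le_norm_sub {ζ : ℂ} (hζ : ζ ∈ slit) :
    ∃ d : ℝ, 0 < d ∧ ∀ r : ℝ, 0 ≤ r → d < ‖(r : ℂ) - ζ‖ := by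
  have hc : IsClosed ((fun x : ℝ ↦ (x : ℂ)) '' Set.Ici 0) :=
    Complex.isometry_ofReal.isClosedEmbedding.isClosedMap _ isClosed_Ici
  obtain ⟨d, hd, h⟩ := Metric.isOpen_iff.mp hc.isOpen_compl ζ hζ
  refine ⟨d / 2, by positivity, fun r hr ↦ ?_⟩
  by_contra! hlt
  exact h (show (r : ℂ) ∈ Metric.ball ζ d by
    rw [Metric.mem_ball, dist_eq_norm]; linarith) ⟨r, hr, rfl⟩

/-- The symbol `1 / (|2πξ|² - ζ)` of the free resolvent. -/
theorem hasTemperateGrowth_inv_symbol (n : ℕ) {ζ : ℂ} (hζ : ζ ∈ slit) :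
    (fun ξ : Rn n ↦ (((2 * π) ^ 2 * ‖ξ‖ ^ 2 : ℝ) - ζ : ℂ)⁻¹).HasTemperateGrowth := by
  obtain ⟨d, hd, hdist⟩ := exists_le_norm_sub hζ
  have ht : IsOpen {z : ℂ | d < ‖z‖} := isOpen_lt continuous_const continuous_norm
  have hne : ∀ z ∈ {z : ℂ | d < ‖z‖}, z ≠ 0 := fun z hz h ↦ by
    simp only [h, Set.mem_ofPred_eq, norm_zero] at hz
    linarith
  refine Function.HasTemperateGrowth.comp' (g := fun z : ℂ ↦ z⁻¹)
    (f := fun ξ : Rn n ↦ (((2 * π) ^ 2 * ‖ξ‖ ^ 2 : ℝ) - ζ : ℂ)) (t := {z : ℂ | d < ‖z‖})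
    ?_ ht.uniqueDiffOn ?_ ?_ (by fun_prop)
  · rintro - ⟨ξ, rfl⟩
    exact hdist _ (by positivity)
  · exact contDiffOn_id.inv hne
  · intro N
    refine ⟨0, ∑ k ∈ Finset.range (N + 1), (k.factorial : ℝ) * (d ^ (k + 1))⁻¹, by positivity,
      fun k hk z hz ↦ ?_⟩
    have hz0 := hne z hz
    have hcd : ContDiffAt ℂ k (fun z : ℂ ↦ z⁻¹) z := contDiffAt_inv ℂ hz0
    rw [iteratedFDerivWithin_of_isOpen k ht hz, ← hcd.restrictScalars_iteratedFDeriv (𝕜 := ℝ)]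
    simp only [Function.comp_apply, pow_zero, mul_one]
    rw [ContinuousMultilinearMap.norm_restrictScalars, norm_iteratedFDeriv_eq_norm_iteratedDeriv,
      iteratedDeriv_eq_iterate, iter_deriv_inv]
    have hbound : ‖(-1 : ℂ) ^ k * (k.factorial : ℂ) * z ^ (-1 - k : ℤ)‖ ≤
        (k.factorial : ℝ) * (d ^ (k + 1))⁻¹ := by
      have : (-1 - k : ℤ) = -((k + 1 : ℕ) : ℤ) := by push_cast; ring
      rw [this, zpow_neg, zpow_natCast]
      simp only [norm_mul, norm_pow, norm_neg, norm_one, one_pow, one_mul, norm_inv,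
        Complex.norm_natCast]
      gcongr
      exact le_of_lt hz
    refine hbound.trans ?_
    exact Finset.single_le_sum (f := fun k : ℕ ↦ (k.factorial : ℝ) * (d ^ (k + 1))⁻¹)
      (fun _ _ ↦ by positivity) (Finset.mem_range.mpr (by omega))

theorem schrodinger_eq_fourierMultiplier (n : ℕ) (ζ : ℂ) :
    schrodinger n ζ = TemperedDistribution.fourierMultiplierCLM ℂ
      (fun ξ : Rn n ↦ (((2 * π) ^ 2 * ‖ξ‖ ^ 2 : ℝ) - ζ : ℂ)) := by
  have h : (fun ξ : Rn n ↦ (((2 * π) ^ 2 * ‖ξ‖ ^ 2 : ℝ) - ζ : ℂ)) =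
      ((((2 * π) ^ 2 : ℝ) : ℂ) • fun ξ : Rn n ↦ ((‖ξ‖ ^ 2 : ℝ) : ℂ)) - fun _ ↦ ζ := by
    ext ξ
    simp
  ext1 u
  rw [h, TemperedDistribution.fourierMultiplierCLM_apply,
    TemperedDistribution.smulLeftCLM_sub (by fun_prop) (by fun_prop),
    TemperedDistribution.smulLeftCLM_smul (by fun_prop), sub_apply,
    TemperedDistribution.smulLeftCLM_const]
  simp only [schrodinger, sub_apply, neg_apply,
    smul_apply, ContinuousLinearMap.id_apply,
    TemperedDistribution.laplacianCLM_apply,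
    TemperedDistribution.laplacian_eq_fourierMultiplierCLM,
    TemperedDistribution.fourierMultiplierCLM_apply]
  rw [sub_eq_add_neg (_ • _), ← neg_smul ζ, FourierTransform.fourierInv_add,
    FourierTransform.fourierInv_smul,
    FourierTransform.fourierInv_smul, FourierTransform.fourierInv_fourier_eq, neg_smul, neg_neg,
    neg_smul, ← sub_eq_add_neg, Complex.coe_smul]

theorem schrodinger_bijective (n : ℕ) {ζ : ℂ} (hζ : ζ ∈ slit) :
    ∃ e : 𝓢'(Rn n, ℂ) ≃L[ℂ] 𝓢'(Rn n, ℂ), (e : 𝓢'(Rn n, ℂ) →L[ℂ] 𝓢'(Rn n, ℂ)) =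
      schrodinger n ζ := by
  obtain ⟨d, hd, hdist⟩ := exists_le_norm_sub hζ
  have hne : ∀ ξ : Rn n, (((2 * π) ^ 2 * ‖ξ‖ ^ 2 : ℝ) - ζ : ℂ) ≠ 0 := fun ξ ↦
    norm_pos_iff.mp (hd.trans (hdist _ (by positivity)))
  have hsym : (fun ξ : Rn n ↦ (((2 * π) ^ 2 * ‖ξ‖ ^ 2 : ℝ) - ζ : ℂ)).HasTemperateGrowth := by
    fun_prop
  have hone : ((fun ξ : Rn n ↦ (((2 * π) ^ 2 * ‖ξ‖ ^ 2 : ℝ) - ζ : ℂ)) *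
      fun ξ : Rn n ↦ (((2 * π) ^ 2 * ‖ξ‖ ^ 2 : ℝ) - ζ : ℂ)⁻¹) = fun _ ↦ (1 : ℂ) := by
    ext ξ
    exact mul_inv_cancel₀ (hne ξ)
  refine ⟨ContinuousLinearEquiv.equivOfInverse (schrodinger n ζ)
    (TemperedDistribution.fourierMultiplierCLM ℂ
      (fun ξ : Rn n ↦ (((2 * π) ^ 2 * ‖ξ‖ ^ 2 : ℝ) - ζ : ℂ)⁻¹)) (fun u ↦ ?_) (fun u ↦ ?_), rfl⟩
  · rw [schrodinger_eq_fourierMultiplier,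
      TemperedDistribution.fourierMultiplierCLM_fourierMultiplierCLM_apply hsym
        (hasTemperateGrowth_inv_symbol n hζ), hone]
    simp
  · rw [schrodinger_eq_fourierMultiplier,
      TemperedDistribution.fourierMultiplierCLM_fourierMultiplierCLM_apply
        (hasTemperateGrowth_inv_symbol n hζ) hsym, mul_comm, hone]
    simp

theorem schrodinger_freeResolvent (n : ℕ) {ζ : ℂ} (hζ : ζ ∈ slit) (u : 𝓢'(Rn n, ℂ)) :
    schrodinger n ζ (freeResolvent n ζ u) = u := by
  obtain ⟨e, he⟩ := schrodinger_bijective n hζ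
  rw [freeResolvent, ← he, ContinuousLinearMap.inverse_equiv]
  exact e.apply_symm_apply u

theorem freeResolvent_schrodinger (n : ℕ) {ζ : ℂ} (hζ : ζ ∈ slit) (u : 𝓢'(Rn n, ℂ)) :
    freeResolvent n ζ (schrodinger n ζ u) = u := by
  obtain ⟨e, he⟩ := schrodinger_bijective n hζ
  rw [freeResolvent, ← he, ContinuousLinearMap.inverse_equiv]
  exact e.symm_apply_apply u

end WeightedSobolev

end

/-!
Conjugation by the isometries `⟨x⟩^σ ⟨∇⟩^s` of the weighted Sobolev spaces onto `L²` turns the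
resolvent `R(ζ)` into `⟨x⟩^{-σ} m(D) ⟨x⟩^{-σ}` with the symbol `m(ξ) = ⟨2πξ⟩^l / (|2πξ|² - ζ)`,
which depends analytically on `ζ` in the supremum norm. For `l = 0`, a Morawetz multiplier together
with the energy identity bounds `√|ζ| R(ζ)` uniformly, and the commutator `[x·∇, R] = 2R + 2ζR²`
trades one power of the weight for the decay `|ζ|^{-1/2}` of one more factor `R`. For general `l`,
expand `⟨2πξ⟩^l` to order `k + 1` at `|2πξ|² = ζ`: the Taylor polynomial contributes powers of `R`,
and the remainder cancels the poles of `R^{k+1}`, so that it is small in the supremum norm.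
-/

noncomputable section

namespace WeightedSobolev

open scoped LineDeriv BoundedContinuousFunction FourierTransform

variable {n : ℕ}

/-- The real weight `⟨x⟩^p = (1 + ‖x‖²)^{p/2}`. -/
def bracketPow (n : ℕ) (p : ℝ) (x : Rn n) : ℝ := (1 + ‖x‖ ^ 2) ^ (p / 2)

theorem bracketPow_pos (p : ℝ) (x : Rn n) : 0 < bracketPow n p x := by
  unfold bracketPow
  positivity

theorem bracketPow_add (p q : ℝ) (x : Rn n) :
    bracketPow n (p + q) x = bracketPow n p x * bracketPow n q x := by
  simp only [bracketPow]
  rw [← Real.rpow_add (by positivity), add_div]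

theorem bracketPow_zero (x : Rn n) : bracketPow n 0 x = 1 := by simp [bracketPow]

theorem bracketPow_two (x : Rn n) : bracketPow n 2 x = 1 + ‖x‖ ^ 2 := by simp [bracketPow]

theorem bracketPow_mono {p q : ℝ} (h : p ≤ q) (x : Rn n) : bracketPow n p x ≤ bracketPow n q x :=
  Real.rpow_le_rpow_of_exponent_le (by nlinarith [sq_nonneg ‖x‖]) (by linarith)

theorem norm_sq_mul_bracketPow (p : ℝ) (x : Rn n) :
    ‖x‖ ^ 2 * bracketPow n (p - 2) x = bracketPow n p x - bracketPow n (p - 2) x := by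
  have h : bracketPow n p x = bracketPow n 2 x * bracketPow n (p - 2) x := by
    rw [← bracketPow_add, add_sub_cancel]
  rw [h, bracketPow_two]
  ring

theorem norm_sq_mul_bracketPow_le (p : ℝ) (x : Rn n) :
    ‖x‖ ^ 2 * bracketPow n (p - 2) x ≤ bracketPow n p x := by
  linarith [norm_sq_mul_bracketPow p x, bracketPow_pos (p - 2) x]

@[fun_prop]
theorem hasTemperateGrowth_bracketPow (p : ℝ) : (bracketPow n p).HasTemperateGrowth := by
  unfold bracketPow
  fun_prop

@[fun_prop]
theorem hasTemperateGrowth_coord (i : Fin n) : (fun x : Rn n ↦ x i).HasTemperateGrowth :=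
  (EuclideanSpace.proj (𝕜 := ℝ) i : Rn n →L[ℝ] ℝ).hasTemperateGrowth

/-- Multiplication of Schwartz functions by a real function, meant for functions of temperate
growth (for other functions it is `0`). -/
def schwartzMul (g : Rn n → ℝ) : 𝓢(Rn n, ℂ) →L[ℂ] 𝓢(Rn n, ℂ) :=
  SchwartzMap.smulLeftCLM ℂ (fun x ↦ (g x : ℂ))

section SchwartzMul

variable {g h : Rn n → ℝ}

theorem schwartzMul_apply (hg : g.HasTemperateGrowth) (u : 𝓢(Rn n, ℂ)) (x : Rn n) :
    schwartzMul g u x = g x * u x := by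
  rw [schwartzMul, SchwartzMap.smulLeftCLM_apply_apply (by fun_prop), smul_eq_mul]

theorem schwartzMul_schwartzMul (hg : g.HasTemperateGrowth) (hh : h.HasTemperateGrowth)
    (u : 𝓢(Rn n, ℂ)) : schwartzMul g (schwartzMul h u) = schwartzMul (fun x ↦ g x * h x) u := by
  ext x
  rw [schwartzMul_apply hg, schwartzMul_apply hh, schwartzMul_apply (by fun_prop),
    Complex.ofReal_mul, mul_assoc]

theorem schwartzMul_comm (hg : g.HasTemperateGrowth) (hh : h.HasTemperateGrowth)
    (u : 𝓢(Rn n, ℂ)) : schwartzMul g (schwartzMul h u) = schwartzMul h (schwartzMul g u) := by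
  rw [schwartzMul_schwartzMul hg hh, schwartzMul_schwartzMul hh hg]
  simp only [mul_comm]

theorem schwartzMul_bracketPow_zero (u : 𝓢(Rn n, ℂ)) : schwartzMul (bracketPow n 0) u = u := by
  ext x
  rw [schwartzMul_apply (by fun_prop), bracketPow_zero, Complex.ofReal_one, one_mul]

theorem schwartzMul_bracketPow_bracketPow (p q : ℝ) (u : 𝓢(Rn n, ℂ)) :
    schwartzMul (bracketPow n p) (schwartzMul (bracketPow n q) u) =
      schwartzMul (bracketPow n (p + q)) u := by
  rw [schwartzMul_schwartzMul (by fun_prop) (by fun_prop), ← funext (bracketPow_add p q)]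

end SchwartzMul

/-- The partial derivative `∂ᵢ` on Schwartz functions. -/
def partialDeriv (i : Fin n) : 𝓢(Rn n, ℂ) →L[ℂ] 𝓢(Rn n, ℂ) :=
  LineDeriv.lineDerivOpCLM ℂ 𝓢(Rn n, ℂ) (EuclideanSpace.single i (1 : ℝ))

theorem partialDeriv_apply (i : Fin n) (u : 𝓢(Rn n, ℂ)) (x : Rn n) :
    partialDeriv i u x = fderiv ℝ u x (EuclideanSpace.single i 1) := rfl

theorem partialDeriv_comm (i j : Fin n) (u : 𝓢(Rn n, ℂ)) :
    partialDeriv i (partialDeriv j u) = partialDeriv j (partialDeriv i u) := by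
  have second_deriv : ∀ (a b : Fin n) (x : Rn n), partialDeriv a (partialDeriv b u) x =
      fderiv ℝ (fderiv ℝ u) x (EuclideanSpace.single a 1) (EuclideanSpace.single b 1) := by
    intro a b x
    have hd : DifferentiableAt ℝ (fderiv ℝ u) x :=
      ((u.smooth 2).fderiv_right (m := 1) (by norm_num)).differentiable (by norm_num) x
    change fderiv ℝ (fun y ↦ fderiv ℝ u y (EuclideanSpace.single b 1)) x _ = _
    rw [(hd.hasFDerivAt.clm_apply
      (hasFDerivAt_const (EuclideanSpace.single b (1 : ℝ)) x)).fderiv]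
    simp
  ext x
  rw [second_deriv, second_deriv]
  exact (u.contDiffAt (n := 2)).isSymmSndFDerivAt (by simp) _ _

theorem partialDeriv_schwartzMul {g g' : Rn n → ℝ} (hg : g.HasTemperateGrowth)
    (hg' : g'.HasTemperateGrowth) (i : Fin n)
    (hd : ∀ x, fderiv ℝ g x (EuclideanSpace.single i 1) = g' x) (u : 𝓢(Rn n, ℂ)) :
    partialDeriv i (schwartzMul g u) = schwartzMul g' u + schwartzMul g (partialDeriv i u) := by
  ext x
  have hgx : HasFDerivAt g (fderiv ℝ g x) x := (hg.1.differentiable (by simp) x).hasFDerivAt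
  have hmul : (schwartzMul g u : Rn n → ℂ) = g • ⇑u := by
    ext y
    simp [schwartzMul_apply hg]
  rw [partialDeriv_apply, hmul, (hgx.smul (u.hasFDerivAt x)).fderiv]
  simp [schwartzMul_apply hg, schwartzMul_apply hg', partialDeriv_apply, hd]
  ring

theorem partialDeriv_coord_mul (i j : Fin n) (u : 𝓢(Rn n, ℂ)) :
    partialDeriv i (schwartzMul (fun x ↦ x j) u) =
      (if i = j then u else 0) + schwartzMul (fun x ↦ x j) (partialDeriv i u) := by
  have hd (x : Rn n) : fderiv ℝ (fun x : Rn n ↦ x j) x (EuclideanSpace.single i 1) =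
      if i = j then 1 else 0 := by
    have hproj : HasFDerivAt (fun x : Rn n ↦ x j) (EuclideanSpace.proj j : Rn n →L[ℝ] ℝ) x :=
      (EuclideanSpace.proj j : Rn n →L[ℝ] ℝ).hasFDerivAt
    rw [hproj.fderiv]
    simp [eq_comm]
  rw [partialDeriv_schwartzMul (g' := fun _ ↦ if i = j then 1 else 0) (by fun_prop) (by fun_prop) i
    hd]
  congr 1
  ext x
  rw [schwartzMul_apply (by fun_prop)]
  split_ifs <;> simp

/-- The Euler operator `x·∇ = ∑ⱼ xⱼ ∂ⱼ` on Schwartz functions. -/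
def euler (n : ℕ) : 𝓢(Rn n, ℂ) →L[ℂ] 𝓢(Rn n, ℂ) :=
  ∑ j, schwartzMul (fun x ↦ x j) ∘L partialDeriv j

theorem euler_eq (u : 𝓢(Rn n, ℂ)) :
    euler n u = ∑ j, schwartzMul (fun x ↦ x j) (partialDeriv j u) := by
  simp [euler]

theorem partialDeriv_euler (i : Fin n) (u : 𝓢(Rn n, ℂ)) :
    partialDeriv i (euler n u) = euler n (partialDeriv i u) + partialDeriv i u := by
  simp only [euler_eq, map_sum, partialDeriv_coord_mul, Finset.sum_add_distrib,
    partialDeriv_comm i, Finset.sum_ite_eq, Finset.mem_univ, if_true]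
  exact add_comm _ _

theorem sum_partialDeriv_coord_mul (u : 𝓢(Rn n, ℂ)) :
    ∑ j, partialDeriv j (schwartzMul (fun x ↦ x j) u) = (n : ℂ) • u + euler n u := by
  simp [partialDeriv_coord_mul, Finset.sum_add_distrib, euler_eq, Nat.cast_smul_eq_nsmul]

/-- The function `g` on `ℝⁿ` has gradient `∇g(x) = h(x) x`, as radial functions do, and `g`, `h`
have temperate growth. -/
structure HasRadialDeriv (g h : Rn n → ℝ) : Prop where
  hasTemperateGrowth : g.HasTemperateGrowth
  hasTemperateGrowth_deriv : h.HasTemperateGrowth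
  hasFDerivAt : ∀ x, HasFDerivAt g (h x • innerSL ℝ x) x

theorem hasRadialDeriv_bracketPow (p : ℝ) :
    HasRadialDeriv (bracketPow n p) (fun x ↦ p * bracketPow n (p - 2) x) where
  hasTemperateGrowth := by fun_prop
  hasTemperateGrowth_deriv := by fun_prop
  hasFDerivAt x := by
    have hsq : HasFDerivAt (fun x : Rn n ↦ 1 + ‖x‖ ^ 2) (2 • innerSL ℝ x) x := by
      simpa using ((hasStrictFDerivAt_norm_sq x).hasFDerivAt.const_add 1)
    refine (hsq.rpow_const (p := p / 2) (Or.inl (by positivity))).congr_fderiv ?_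
    ext v
    simp [bracketPow, sub_div]
    ring

namespace HasRadialDeriv

variable {g h g₁ h₁ : Rn n → ℝ}

theorem const_mul (hg : HasRadialDeriv g h) (a : ℝ) :
    HasRadialDeriv (fun x ↦ a * g x) (fun x ↦ a * h x) where
  hasTemperateGrowth := (Function.HasTemperateGrowth.const a).mul hg.1
  hasTemperateGrowth_deriv := (Function.HasTemperateGrowth.const a).mul hg.2
  hasFDerivAt x := by simpa only [mul_smul] using (hg.3 x).const_mul a

theorem add (hg : HasRadialDeriv g h) (hg₁ : HasRadialDeriv g₁ h₁) :
    HasRadialDeriv (fun x ↦ g x + g₁ x) (fun x ↦ h x + h₁ x) where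
  hasTemperateGrowth := hg.1.add hg₁.1
  hasTemperateGrowth_deriv := hg.2.add hg₁.2
  hasFDerivAt x := by simpa only [add_smul] using (hg.3 x).fun_add (hg₁.3 x)

theorem norm_sq_mul (hg : HasRadialDeriv g h) :
    HasRadialDeriv (fun x ↦ ‖x‖ ^ 2 * g x) (fun x ↦ 2 * g x + ‖x‖ ^ 2 * h x) where
  hasTemperateGrowth := by
    have := hg.1
    fun_prop
  hasTemperateGrowth_deriv := by
    have := hg.1
    have := hg.2
    fun_prop
  hasFDerivAt x := by
    refine ((hasStrictFDerivAt_norm_sq x).hasFDerivAt.fun_mul (hg.3 x)).congr_fderiv ?_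
    ext v
    simp
    ring

theorem partialDeriv_schwartzMul (hg : HasRadialDeriv g h) (i : Fin n) (u : 𝓢(Rn n, ℂ)) :
    partialDeriv i (schwartzMul g u) =
      schwartzMul (fun x ↦ x i) (schwartzMul h u) + schwartzMul g (partialDeriv i u) := by
  have := hg.2
  rw [schwartzMul_schwartzMul (by fun_prop) hg.2]
  refine WeightedSobolev.partialDeriv_schwartzMul hg.1 (by fun_prop) i (fun x ↦ ?_) u
  simp [(hg.3 x).fderiv, EuclideanSpace.inner_single_right, mul_comm]

theorem euler_schwartzMul (hg : HasRadialDeriv g h) (u : 𝓢(Rn n, ℂ)) :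
    euler n (schwartzMul g u) =
      schwartzMul (fun x ↦ ‖x‖ ^ 2 * h x) u + schwartzMul g (euler n u) := by
  have := hg.2
  simp only [euler_eq, hg.partialDeriv_schwartzMul, map_add, Finset.sum_add_distrib, map_sum]
  congr 1
  · ext x
    rw [schwartzMul_apply (by fun_prop)]
    simp only [sum_apply, schwartzMul_apply (hasTemperateGrowth_coord _), schwartzMul_apply hg.2,
      EuclideanSpace.norm_sq_eq, Real.norm_eq_abs, sq_abs]
    push_cast
    simp only [← mul_assoc, ← Finset.sum_mul, sq]
  · exact Finset.sum_congr rfl fun j _ ↦ schwartzMul_comm (by fun_prop) hg.1 _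

end HasRadialDeriv

/-- The inclusion of the Schwartz functions into `L²`. -/
def schwartzToL2 (n : ℕ) : 𝓢(Rn n, ℂ) →L[ℂ] Lp ℂ 2 (volume : Measure (Rn n)) :=
  SchwartzMap.toLpCLM ℂ ℂ 2 volume

/-- The `L²` inner product of Schwartz functions, antilinear in the first argument. -/
local notation "⟪" u "," v "⟫" => inner ℂ (schwartzToL2 _ u) (schwartzToL2 _ v)

theorem inner_eq_integral (u v : 𝓢(Rn n, ℂ)) : ⟪u, v⟫ = ∫ x, inner ℂ (u x) (v x) :=
  SchwartzMap.inner_toL2_toL2_eq u v volume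

theorem inner_schwartzMul_left {g : Rn n → ℝ} (hg : g.HasTemperateGrowth) (u v : 𝓢(Rn n, ℂ)) :
    ⟪schwartzMul g u, v⟫ = ⟪u, schwartzMul g v⟫ := by
  simp only [inner_eq_integral, schwartzMul_apply hg]
  refine integral_congr_ae (.of_forall fun x ↦ ?_)
  simp only [RCLike.inner_apply, map_mul, Complex.conj_ofReal]
  ring

theorem inner_partialDeriv_left (i : Fin n) (u v : 𝓢(Rn n, ℂ)) :
    ⟪partialDeriv i u, v⟫ = -⟪u, partialDeriv i v⟫ := by
  have inner_eq : ∀ a b : ℂ, inner ℂ a b = ((ContinuousLinearMap.mul ℝ ℂ).comp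
      (Complex.conjCLE : ℂ →L[ℝ] ℂ)) a b := fun a b ↦ by simp [mul_comm]
  simp only [inner_eq_integral, inner_eq]
  exact (neg_eq_iff_eq_neg.mpr <| SchwartzMap.integral_bilinear_lineDerivOp_right_eq_neg_left u v
    ((ContinuousLinearMap.mul ℝ ℂ).comp (Complex.conjCLE : ℂ →L[ℝ] ℂ))
      (EuclideanSpace.single i (1 : ℝ))).symm

theorem norm_schwartzToL2_le {u v : 𝓢(Rn n, ℂ)} {C : ℝ} (h : ∀ x, ‖u x‖ ≤ C * ‖v x‖) :
    ‖schwartzToL2 n u‖ ≤ C * ‖schwartzToL2 n v‖ := by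
  refine Lp.norm_le_mul_norm_of_ae_le_mul ?_
  filter_upwards [u.coeFn_toLp 2 volume, v.coeFn_toLp 2 volume] with x hu hv
  change ‖(u.toLp 2 volume : Rn n → ℂ) x‖ ≤ C * ‖(v.toLp 2 volume : Rn n → ℂ) x‖
  rw [hu, hv]
  exact h x

theorem integrable_inner_schwartz (u v : 𝓢(Rn n, ℂ)) :
    Integrable (fun x ↦ inner ℂ (u x) (v x)) := by
  refine (L2.integrable_inner (𝕜 := ℂ) (schwartzToL2 n u) (schwartzToL2 n v)).congr ?_
  filter_upwards [u.coeFn_toLp 2 volume, v.coeFn_toLp 2 volume] with x hu hv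
  change inner ℂ ((u.toLp 2 volume : Rn n → ℂ) x) ((v.toLp 2 volume : Rn n → ℂ) x) = _
  rw [hu, hv]

theorem re_inner_schwartzMul_apply_self {g : Rn n → ℝ} (hg : g.HasTemperateGrowth)
    (u : 𝓢(Rn n, ℂ)) (x : Rn n) : (inner ℂ (schwartzMul g u x) (u x)).re = g x * ‖u x‖ ^ 2 := by
  rw [schwartzMul_apply hg, ← Complex.real_smul, inner_smul_left_eq_smul, Complex.smul_re,
    smul_eq_mul]
  congr 1
  exact inner_self_eq_norm_sq (𝕜 := ℂ) (u x)

theorem integrable_mul_norm_sq {g : Rn n → ℝ} (hg : g.HasTemperateGrowth) (u : 𝓢(Rn n, ℂ)) :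
    Integrable (fun x ↦ g x * ‖u x‖ ^ 2) := by
  simp only [← re_inner_schwartzMul_apply_self hg]
  exact (integrable_inner_schwartz (schwartzMul g u) u).re

theorem re_inner_schwartzMul_self {g : Rn n → ℝ} (hg : g.HasTemperateGrowth) (u : 𝓢(Rn n, ℂ)) :
    ⟪schwartzMul g u, u⟫.re = ∫ x, g x * ‖u x‖ ^ 2 := by
  simp only [inner_eq_integral, ← re_inner_schwartzMul_apply_self hg]
  exact (integral_re (integrable_inner_schwartz (schwartzMul g u) u)).symm

/-- The weighted norm `‖⟨x⟩^p u‖_{L²}` of a Schwartz function. -/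
def weightedNorm (p : ℝ) : Seminorm ℂ 𝓢(Rn n, ℂ) :=
  (normSeminorm ℂ (Lp ℂ 2 (volume : Measure (Rn n)))).comp
    (schwartzToL2 n ∘L schwartzMul (bracketPow n p)).toLinearMap

theorem weightedNorm_apply (p : ℝ) (u : 𝓢(Rn n, ℂ)) :
    weightedNorm p u = ‖schwartzToL2 n (schwartzMul (bracketPow n p) u)‖ := rfl

theorem weightedNorm_schwartzMul_le {g : Rn n → ℝ} (hg : g.HasTemperateGrowth) {p q C : ℝ}
    (h : ∀ x, |g x| ≤ C * bracketPow n (q - p) x) (u : 𝓢(Rn n, ℂ)) :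
    weightedNorm p (schwartzMul g u) ≤ C * weightedNorm q u := by
  rw [weightedNorm_apply, weightedNorm_apply]
  refine norm_schwartzToL2_le fun x ↦ ?_
  have hp : |bracketPow n p x| = bracketPow n p x := abs_of_pos (bracketPow_pos p x)
  have hq : |bracketPow n q x| = bracketPow n q x := abs_of_pos (bracketPow_pos q x)
  rw [schwartzMul_apply (by fun_prop), schwartzMul_apply hg, schwartzMul_apply (by fun_prop)]
  simp only [norm_mul, Complex.norm_real, Real.norm_eq_abs, hp, hq]
  calc bracketPow n p x * (|g x| * ‖u x‖)
      ≤ bracketPow n p x * (C * bracketPow n (q - p) x * ‖u x‖) := by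
        gcongr
        exacts [(bracketPow_pos _ _).le, h x]
    _ = C * (bracketPow n (p + (q - p)) x * ‖u x‖) := by rw [bracketPow_add]; ring
    _ = C * (bracketPow n q x * ‖u x‖) := by rw [add_sub_cancel]

theorem weightedNorm_mono {p q : ℝ} (h : p ≤ q) (u : 𝓢(Rn n, ℂ)) :
    weightedNorm p u ≤ weightedNorm q u := by
  have := weightedNorm_schwartzMul_le (g := bracketPow n 0) (p := p) (q := q) (C := 1)
    (by fun_prop) (fun x ↦ by
      rw [abs_of_pos (bracketPow_pos 0 x), one_mul]
      exact bracketPow_mono (sub_nonneg.mpr h) x) u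
  rwa [schwartzMul_bracketPow_zero, one_mul] at this

theorem weightedNorm_sq (p : ℝ) (u : 𝓢(Rn n, ℂ)) :
    weightedNorm p u ^ 2 = ∫ x, bracketPow n (2 * p) x * ‖u x‖ ^ 2 := by
  rw [← re_inner_schwartzMul_self (by fun_prop), two_mul, ← schwartzMul_bracketPow_bracketPow,
    inner_schwartzMul_left (by fun_prop), weightedNorm_apply]
  exact (inner_self_eq_norm_sq (𝕜 := ℂ) _).symm

theorem inner_schwartzMul_bracketPow_self (p : ℝ) (u : 𝓢(Rn n, ℂ)) :
    ⟪schwartzMul (bracketPow n (2 * p)) u, u⟫ = (weightedNorm p u ^ 2 : ℝ) := by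
  rw [two_mul, ← schwartzMul_bracketPow_bracketPow, inner_schwartzMul_left (by fun_prop),
    inner_self_eq_norm_sq_to_K, weightedNorm_apply]
  norm_cast

theorem inner_self_eq_weightedNorm_zero_sq (u : 𝓢(Rn n, ℂ)) :
    ⟪u, u⟫ = (weightedNorm 0 u ^ 2 : ℝ) := by
  rw [← inner_schwartzMul_bracketPow_self, mul_zero, schwartzMul_bracketPow_zero]

theorem norm_inner_schwartzMul_le {g : Rn n → ℝ} (hg : g.HasTemperateGrowth) {p q C : ℝ}
    (h : ∀ x, |g x| ≤ C * bracketPow n (p + q) x) (u v : 𝓢(Rn n, ℂ)) :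
    ‖⟪schwartzMul g u, v⟫‖ ≤ C * weightedNorm p u * weightedNorm q v := by
  have hv : v = schwartzMul (bracketPow n (-q)) (schwartzMul (bracketPow n q) v) := by
    rw [schwartzMul_bracketPow_bracketPow, neg_add_cancel, schwartzMul_bracketPow_zero]
  rw [hv, ← inner_schwartzMul_left (by fun_prop), ← hv]
  refine (norm_inner_le_norm _ _).trans (mul_le_mul_of_nonneg_right ?_ (norm_nonneg _))
  exact weightedNorm_schwartzMul_le hg (p := -q) (q := p) (by simpa only [sub_neg_eq_add] using h) u

theorem norm_inner_le_weightedNorm (p : ℝ) (u v : 𝓢(Rn n, ℂ)) :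
    ‖⟪u, v⟫‖ ≤ weightedNorm (-p) u * weightedNorm p v := by
  have := norm_inner_schwartzMul_le (g := bracketPow n 0) (p := -p) (q := p) (C := 1)
    (by fun_prop) (fun x ↦ by rw [abs_of_pos (bracketPow_pos 0 x), neg_add_cancel, one_mul]) u v
  rwa [schwartzMul_bracketPow_zero, one_mul] at this

/-- The weighted norm `‖⟨x⟩^p ∇u‖_{L²}` of the gradient of a Schwartz function. -/
def weightedGradNorm (p : ℝ) (u : 𝓢(Rn n, ℂ)) : ℝ :=
  √(∑ i, weightedNorm p (partialDeriv i u) ^ 2)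

theorem weightedGradNorm_nonneg (p : ℝ) (u : 𝓢(Rn n, ℂ)) : 0 ≤ weightedGradNorm p u :=
  Real.sqrt_nonneg _

theorem weightedGradNorm_sq (p : ℝ) (u : 𝓢(Rn n, ℂ)) :
    weightedGradNorm p u ^ 2 = ∑ i, weightedNorm p (partialDeriv i u) ^ 2 :=
  Real.sq_sqrt (by positivity)

theorem weightedNorm_partialDeriv_le (p : ℝ) (i : Fin n) (u : 𝓢(Rn n, ℂ)) :
    weightedNorm p (partialDeriv i u) ≤ weightedGradNorm p u :=
  Real.le_sqrt_of_sq_le <| Finset.single_le_sum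
    (f := fun i ↦ weightedNorm p (partialDeriv i u) ^ 2) (fun _ _ ↦ sq_nonneg _) (Finset.mem_univ i)

theorem weightedGradNorm_mono {p q : ℝ} (h : p ≤ q) (u : 𝓢(Rn n, ℂ)) :
    weightedGradNorm p u ≤ weightedGradNorm q u :=
  Real.sqrt_le_sqrt <| Finset.sum_le_sum fun _ _ ↦
    pow_le_pow_left₀ (apply_nonneg _ _) (weightedNorm_mono h _) 2

theorem norm_euler_apply_sq_le (u : 𝓢(Rn n, ℂ)) (x : Rn n) :
    ‖euler n u x‖ ^ 2 ≤ ‖x‖ ^ 2 * ∑ j, ‖partialDeriv j u x‖ ^ 2 := by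
  have norm_le : ‖euler n u x‖ ≤ ∑ j, |x j| * ‖partialDeriv j u x‖ := by
    rw [euler_eq, sum_apply]
    refine (norm_sum_le _ _).trans (Finset.sum_le_sum fun j _ ↦ ?_)
    rw [schwartzMul_apply (by fun_prop), norm_mul, Complex.norm_real, Real.norm_eq_abs]
  refine (pow_le_pow_left₀ (norm_nonneg _) norm_le 2).trans ?_
  simpa only [EuclideanSpace.norm_sq_eq, Real.norm_eq_abs] using
    Finset.sum_mul_sq_le_sq_mul_sq Finset.univ (fun j ↦ |x j|) fun j ↦ ‖partialDeriv j u x‖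

theorem integral_mul_norm_euler_sq_le {g : Rn n → ℝ} (hg : g.HasTemperateGrowth)
    (hg0 : ∀ x, 0 ≤ g x) (u : 𝓢(Rn n, ℂ)) :
    ∫ x, g x * ‖euler n u x‖ ^ 2 ≤ ∑ j, ∫ x, ‖x‖ ^ 2 * g x * ‖partialDeriv j u x‖ ^ 2 := by
  have integrable_term : ∀ j ∈ Finset.univ,
      Integrable (fun x ↦ ‖x‖ ^ 2 * g x * ‖partialDeriv j u x‖ ^ 2) :=
    fun j _ ↦ integrable_mul_norm_sq (by fun_prop) _
  rw [← integral_finsetSum _ integrable_term]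
  refine integral_mono (integrable_mul_norm_sq hg _)
    (integrable_finsetSum _ integrable_term) fun x ↦ ?_
  calc g x * ‖euler n u x‖ ^ 2 ≤ g x * (‖x‖ ^ 2 * ∑ j, ‖partialDeriv j u x‖ ^ 2) :=
        mul_le_mul_of_nonneg_left (norm_euler_apply_sq_le u x) (hg0 x)
    _ = ∑ j, ‖x‖ ^ 2 * g x * ‖partialDeriv j u x‖ ^ 2 := by rw [← Finset.mul_sum]; ring

theorem weightedNorm_euler_le (p : ℝ) (u : 𝓢(Rn n, ℂ)) :
    weightedNorm p (euler n u) ≤ weightedGradNorm (p + 1) u := by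
  refine le_of_sq_le_sq ?_ (weightedGradNorm_nonneg _ _)
  simp only [weightedGradNorm_sq, weightedNorm_sq]
  refine (integral_mul_norm_euler_sq_le (by fun_prop) (fun x ↦ (bracketPow_pos _ x).le) u).trans ?_
  refine Finset.sum_le_sum fun j _ ↦ integral_mono (integrable_mul_norm_sq (by fun_prop) _)
    (integrable_mul_norm_sq (by fun_prop) _) fun x ↦ ?_
  have := norm_sq_mul_bracketPow_le (2 * (p + 1)) x
  rw [show 2 * (p + 1) - 2 = 2 * p by ring] at this
  exact mul_le_mul_of_nonneg_right this (sq_nonneg _)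

/-- The operator `-Δ - ζ` on Schwartz functions. -/
def schwartzSchrodinger (n : ℕ) (ζ : ℂ) : 𝓢(Rn n, ℂ) →L[ℂ] 𝓢(Rn n, ℂ) :=
  -(∑ i, partialDeriv i ∘L partialDeriv i) - ζ • ContinuousLinearMap.id ℂ _

theorem schwartzSchrodinger_apply (ζ : ℂ) (u : 𝓢(Rn n, ℂ)) :
    schwartzSchrodinger n ζ u = -(∑ i, partialDeriv i (partialDeriv i u)) - ζ • u := by
  simp [schwartzSchrodinger]

theorem inner_schwartzSchrodinger (ζ : ℂ) (u v : 𝓢(Rn n, ℂ)) :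
    ⟪v, schwartzSchrodinger n ζ u⟫ =
      ∑ i, ⟪partialDeriv i v, partialDeriv i u⟫ - ζ * ⟪v, u⟫ := by
  simp only [schwartzSchrodinger_apply, map_sub, map_neg, map_sum, map_smul, inner_sub_right,
    inner_neg_right, inner_sum, inner_smul_right, inner_partialDeriv_left, Finset.sum_neg_distrib]

theorem sum_inner_coord_mul (u v : 𝓢(Rn n, ℂ)) :
    ∑ i, ⟪schwartzMul (fun x ↦ x i) u, partialDeriv i v⟫ = ⟪u, euler n v⟫ := by
  simp only [euler_eq, map_sum, inner_sum]
  exact Finset.sum_congr rfl fun i _ ↦ inner_schwartzMul_left (by fun_prop) _ _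

theorem HasRadialDeriv.inner_schwartzMul_schwartzSchrodinger {g h : Rn n → ℝ}
    (hg : HasRadialDeriv g h) (ζ : ℂ) (u : 𝓢(Rn n, ℂ)) :
    ⟪schwartzMul g u, schwartzSchrodinger n ζ u⟫ =
      ⟪schwartzMul h u, euler n u⟫ +
        ∑ i, ⟪schwartzMul g (partialDeriv i u), partialDeriv i u⟫ - ζ * ⟪schwartzMul g u, u⟫ := by
  simp only [inner_schwartzSchrodinger, hg.partialDeriv_schwartzMul, map_add, inner_add_left,
    Finset.sum_add_distrib, sum_inner_coord_mul]

/-- The energy identity with the weight `⟨x⟩^{-2σ}`, as an estimate: the error terms are the one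
in which a derivative falls on the weight and the source term. -/
theorem norm_weighted_energy_le {σ : ℝ} (hσ : 0 ≤ σ) (ζ : ℂ) (u : 𝓢(Rn n, ℂ)) :
    ‖((weightedGradNorm (-σ) u ^ 2 : ℝ) : ℂ) - ζ * (weightedNorm (-σ) u ^ 2 : ℝ)‖ ≤
      2 * σ * (weightedNorm (-σ) u * weightedGradNorm (-σ) u) +
        weightedNorm (-σ) u * weightedNorm (-σ) (schwartzSchrodinger n ζ u) := by
  have energy := (hasRadialDeriv_bracketPow (n := n) (2 * -σ)).inner_schwartzMul_schwartzSchrodinger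
    ζ u
  simp only [inner_schwartzMul_bracketPow_self, ← Complex.ofReal_sum, ← weightedGradNorm_sq]
    at energy
  have weight_term : ‖⟪schwartzMul (fun x ↦ 2 * -σ * bracketPow n (2 * -σ - 2) x) u, euler n u⟫‖ ≤
      2 * σ * (weightedNorm (-σ) u * weightedGradNorm (-σ) u) := by
    refine (norm_inner_schwartzMul_le (p := -σ) (q := -σ - 2) (C := 2 * σ) (by fun_prop)
      (fun x ↦ ?_) _ _).trans ?_
    · rw [show -σ + (-σ - 2) = 2 * -σ - 2 by ring, abs_mul, abs_of_nonpos (by linarith),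
        abs_of_pos (bracketPow_pos _ x), mul_neg, neg_neg]
    · rw [mul_assoc]
      gcongr
      exact (weightedNorm_euler_le _ u).trans (weightedGradNorm_mono (by linarith) u)
  have source_term : ‖⟪schwartzMul (bracketPow n (2 * -σ)) u, schwartzSchrodinger n ζ u⟫‖ ≤
      weightedNorm (-σ) u * weightedNorm (-σ) (schwartzSchrodinger n ζ u) := by
    rw [two_mul, ← schwartzMul_bracketPow_bracketPow, inner_schwartzMul_left (by fun_prop)]
    exact norm_inner_le_norm _ _
  rw [show ((weightedGradNorm (-σ) u ^ 2 : ℝ) : ℂ) - ζ * (weightedNorm (-σ) u ^ 2 : ℝ) =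
      ⟪schwartzMul (bracketPow n (2 * -σ)) u, schwartzSchrodinger n ζ u⟫ -
        ⟪schwartzMul (fun x ↦ 2 * -σ * bracketPow n (2 * -σ - 2) x) u, euler n u⟫ by
    rw [energy]; ring]
  exact (norm_sub_le _ _).trans (by linarith)

section RadialMultiplier

variable {g h k : Rn n → ℝ}

/-- The divergence `n g + |x|² h` of the vector field `g(x) x`, where `h` is the radial derivative
of `g` in the sense of `HasRadialDeriv`. -/
def radialDivergence (g h : Rn n → ℝ) (x : Rn n) : ℝ := n * g x + ‖x‖ ^ 2 * h x

@[fun_prop]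
theorem hasTemperateGrowth_radialDivergence (hg : g.HasTemperateGrowth)
    (hh : h.HasTemperateGrowth) : (radialDivergence g h).HasTemperateGrowth := by
  unfold radialDivergence
  fun_prop

theorem hasRadialDeriv_radialDivergence (hg : HasRadialDeriv g h) (hh : HasRadialDeriv h k) :
    HasRadialDeriv (radialDivergence g h) (fun x ↦ (n + 2) * h x + ‖x‖ ^ 2 * k x) := by
  unfold radialDivergence
  simpa only [add_mul, add_assoc] using (hg.const_mul n).add hh.norm_sq_mul

/-- The antisymmetric operator `2 g x·∇ + div (g x)` attached to the vector field `g(x) x`, where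
`h` is the radial derivative of `g`. -/
def radialMultiplier (g h : Rn n → ℝ) : 𝓢(Rn n, ℂ) →L[ℂ] 𝓢(Rn n, ℂ) :=
  (2 : ℂ) • (schwartzMul g ∘L euler n) + schwartzMul (radialDivergence g h)

theorem radialMultiplier_apply (u : 𝓢(Rn n, ℂ)) :
    radialMultiplier g h u =
      (2 : ℂ) • schwartzMul g (euler n u) + schwartzMul (radialDivergence g h) u := by
  simp [radialMultiplier]

theorem inner_euler_left (u v : 𝓢(Rn n, ℂ)) :
    ⟪euler n u, v⟫ = -⟪u, (n : ℂ) • v + euler n v⟫ := by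
  rw [← sum_partialDeriv_coord_mul, euler_eq]
  simp only [map_sum, sum_inner, inner_sum, ← Finset.sum_neg_distrib]
  exact Finset.sum_congr rfl fun j _ ↦ by
    rw [inner_schwartzMul_left (by fun_prop), inner_partialDeriv_left]

theorem HasRadialDeriv.inner_schwartzMul_euler_left (hg : HasRadialDeriv g h) (u v : 𝓢(Rn n, ℂ)) :
    ⟪schwartzMul g (euler n u), v⟫ =
      -⟪u, schwartzMul (radialDivergence g h) v + schwartzMul g (euler n v)⟫ := by
  have hh := hg.hasTemperateGrowth_deriv
  rw [inner_schwartzMul_left hg.1, inner_euler_left, hg.euler_schwartzMul, ← add_assoc]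
  congr 5
  ext x
  simp only [add_apply, smul_apply, schwartzMul_apply hg.1, smul_eq_mul,
    schwartzMul_apply (hasTemperateGrowth_radialDivergence hg.1 hh)]
  rw [schwartzMul_apply (by fun_prop)]
  simp only [radialDivergence]
  push_cast
  ring

theorem HasRadialDeriv.re_inner_radialMultiplier_self (hg : HasRadialDeriv g h)
    (u : 𝓢(Rn n, ℂ)) : ⟪radialMultiplier g h u, u⟫.re = 0 := by
  have antisymm := congrArg Complex.re (hg.inner_schwartzMul_euler_left u u)
  have symm : ∀ v w : 𝓢(Rn n, ℂ), ⟪v, w⟫.re = ⟪w, v⟫.re := fun v w ↦ inner_re_symm (𝕜 := ℂ) _ _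
  simp only [map_add, inner_add_right, Complex.neg_re, Complex.add_re, symm u] at antisymm
  simp only [radialMultiplier_apply, map_add, map_smul, inner_add_left, inner_smul_left,
    map_ofNat, Complex.add_re, Complex.mul_re, Complex.re_ofNat, Complex.im_ofNat, zero_mul,
    sub_zero]
  linarith

theorem HasRadialDeriv.partialDeriv_radialMultiplier (hg : HasRadialDeriv g h)
    (hh : HasRadialDeriv h k) (i : Fin n) (u : 𝓢(Rn n, ℂ)) :
    partialDeriv i (radialMultiplier g h u) = radialMultiplier g h (partialDeriv i u) +
      (2 : ℂ) • schwartzMul (fun x ↦ x i) (schwartzMul h (euler n u)) +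
      (2 : ℂ) • schwartzMul g (partialDeriv i u) +
      schwartzMul (fun x ↦ x i) (schwartzMul (fun x ↦ (n + 2) * h x + ‖x‖ ^ 2 * k x) u) := by
  simp only [radialMultiplier_apply, map_add, map_smul, hg.partialDeriv_schwartzMul,
    (hasRadialDeriv_radialDivergence hg hh).partialDeriv_schwartzMul, partialDeriv_euler, smul_add]
  abel

/-- The Morawetz identity. The antisymmetry of the multiplier removes the terms in which its second
factor is differentiated, and leaves only the imaginary part of `ζ`. -/
theorem HasRadialDeriv.re_inner_radialMultiplier_schwartzSchrodinger (hg : HasRadialDeriv g h)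
    (hh : HasRadialDeriv h k) (ζ : ℂ) (u : 𝓢(Rn n, ℂ)) :
    ⟪radialMultiplier g h u, schwartzSchrodinger n ζ u⟫.re =
      2 * (⟪schwartzMul h (euler n u), euler n u⟫.re +
        ∑ i, ⟪schwartzMul g (partialDeriv i u), partialDeriv i u⟫.re) +
      ⟪schwartzMul (fun x ↦ (n + 2) * h x + ‖x‖ ^ 2 * k x) u, euler n u⟫.re +
      ζ.im * ⟪radialMultiplier g h u, u⟫.im := by
  simp only [inner_schwartzSchrodinger, hg.partialDeriv_radialMultiplier hh, map_add, map_smul,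
    inner_add_left, inner_smul_left, Finset.sum_add_distrib, ← Finset.mul_sum,
    sum_inner_coord_mul, map_ofNat]
  simp only [Complex.sub_re, Complex.add_re, Complex.mul_re, Complex.re_ofNat, Complex.im_ofNat,
    Complex.re_sum, hg.re_inner_radialMultiplier_self, Finset.sum_const_zero, mul_zero]
  ring

theorem norm_inner_radialMultiplier_le (hg : g.HasTemperateGrowth) (hh : h.HasTemperateGrowth)
    {A B : ℝ} (hA : ∀ x, |g x| ≤ A * bracketPow n (-1) x)
    (hB : ∀ x, |radialDivergence g h x| ≤ B) (p : ℝ) (u v : 𝓢(Rn n, ℂ)) :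
    ‖⟪radialMultiplier g h u, v⟫‖ ≤
      (2 * A * weightedGradNorm (-p) u + B * weightedNorm (-p) u) * weightedNorm p v := by
  have hA0 : 0 ≤ A := nonneg_of_mul_nonneg_left ((abs_nonneg _).trans (hA 0)) (bracketPow_pos _ _)
  have first_order : ‖⟪schwartzMul g (euler n u), v⟫‖ ≤
      A * weightedGradNorm (-p) u * weightedNorm p v := by
    rw [show -1 = -p - 1 + p by ring] at hA
    refine (norm_inner_schwartzMul_le hg hA _ _).trans ?_
    gcongr
    simpa using weightedNorm_euler_le (-p - 1) u
  have zeroth_order : ‖⟪schwartzMul (radialDivergence g h) u, v⟫‖ ≤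
      B * weightedNorm (-p) u * weightedNorm p v :=
    norm_inner_schwartzMul_le (hasTemperateGrowth_radialDivergence hg hh)
      (fun x ↦ by simpa [bracketPow_zero] using hB x) _ _
  simp only [radialMultiplier_apply, map_add, map_smul, inner_add_left, inner_smul_left, map_ofNat]
  refine (norm_add_le _ _).trans ?_
  rw [norm_mul, Complex.norm_ofNat]
  linarith

theorem sum_re_inner_schwartzMul_partialDeriv_le {w : Rn n → ℝ} (hg : g.HasTemperateGrowth)
    (hh : h.HasTemperateGrowth) (hw : w.HasTemperateGrowth) (hh0 : ∀ x, h x ≤ 0)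
    (hwgh : ∀ x, w x ≤ g x + ‖x‖ ^ 2 * h x) (u : 𝓢(Rn n, ℂ)) :
    ∑ i, ⟪schwartzMul w (partialDeriv i u), partialDeriv i u⟫.re ≤
      ⟪schwartzMul h (euler n u), euler n u⟫.re +
        ∑ i, ⟪schwartzMul g (partialDeriv i u), partialDeriv i u⟫.re := by
  simp only [re_inner_schwartzMul_self, hg, hh, hw]
  have heuler := integral_mul_norm_euler_sq_le hh.neg (fun x ↦ neg_nonneg.mpr (hh0 x)) u
  have hderiv : ∀ i, ∫ x, ‖x‖ ^ 2 * -h x * ‖partialDeriv i u x‖ ^ 2 ≤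
      (∫ x, g x * ‖partialDeriv i u x‖ ^ 2) - ∫ x, w x * ‖partialDeriv i u x‖ ^ 2 := fun i ↦ by
    rw [← integral_sub (integrable_mul_norm_sq hg _) (integrable_mul_norm_sq hw _)]
    refine integral_mono (integrable_mul_norm_sq (by fun_prop) _)
      ((integrable_mul_norm_sq hg _).sub (integrable_mul_norm_sq hw _)) fun x ↦ ?_
    simp only [← sub_mul]
    exact mul_le_mul_of_nonneg_right (by linarith [hwgh x]) (sq_nonneg _)
  have hsum := heuler.trans (Finset.sum_le_sum fun i _ ↦ hderiv i)
  simp only [Pi.neg_apply, neg_mul, integral_neg, Finset.sum_sub_distrib] at hsum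
  linarith

end RadialMultiplier

/-- The profile `g = 2⟨x⟩⁻¹ - ⟨x⟩^{-1-δ}` of the Morawetz multiplier. It is chosen so that
`g ∼ ⟨x⟩⁻¹` decreases, while `g + |x|² h`, with `h` the radial derivative of `g`, is still bounded
below by `δ ⟨x⟩^{-1-δ}`. -/
def morawetzProfile (n : ℕ) (δ : ℝ) (x : Rn n) : ℝ :=
  2 * bracketPow n (-1) x - bracketPow n (-1 - δ) x

/-- The radial derivative of `morawetzProfile`. -/
def morawetzProfileDeriv (n : ℕ) (δ : ℝ) (x : Rn n) : ℝ :=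
  -2 * bracketPow n (-3) x + (1 + δ) * bracketPow n (-3 - δ) x

/-- The radial derivative of `morawetzProfileDeriv`. -/
def morawetzProfileDeriv₂ (n : ℕ) (δ : ℝ) (x : Rn n) : ℝ :=
  6 * bracketPow n (-5) x - (1 + δ) * (3 + δ) * bracketPow n (-5 - δ) x

theorem hasRadialDeriv_morawetzProfile (δ : ℝ) :
    HasRadialDeriv (morawetzProfile n δ) (morawetzProfileDeriv n δ) := by
  convert ((hasRadialDeriv_bracketPow (-1)).const_mul 2).add
    ((hasRadialDeriv_bracketPow (-1 - δ)).const_mul (-1)) using 1 <;> funext x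
  · simp only [morawetzProfile]
    ring
  · simp only [morawetzProfileDeriv]
    ring_nf

theorem hasRadialDeriv_morawetzProfileDeriv (δ : ℝ) :
    HasRadialDeriv (morawetzProfileDeriv n δ) (morawetzProfileDeriv₂ n δ) := by
  convert ((hasRadialDeriv_bracketPow (-3)).const_mul (-2)).add
    ((hasRadialDeriv_bracketPow (-3 - δ)).const_mul (1 + δ)) using 1
  · rfl
  · funext x
    simp only [morawetzProfileDeriv₂]
    ring_nf

section ProfileBounds

variable {δ : ℝ}

theorem abs_morawetzProfile_le (hδ : 0 ≤ δ) (x : Rn n) :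
    |morawetzProfile n δ x| ≤ 2 * bracketPow n (-1) x := by
  have hle := bracketPow_mono (by linarith : -1 - δ ≤ -1) x
  have hpos := bracketPow_pos (-1 - δ) x
  rw [abs_le]
  constructor <;> simp only [morawetzProfile] <;> linarith

theorem morawetzProfileDeriv_nonpos (hδ : 0 ≤ δ) (hδ1 : δ ≤ 1) (x : Rn n) :
    morawetzProfileDeriv n δ x ≤ 0 := by
  have hle := bracketPow_mono (by linarith : -3 - δ ≤ -3) x
  have hpos := bracketPow_pos (-3 - δ) x
  simp only [morawetzProfileDeriv]
  nlinarith

theorem abs_morawetzProfileDeriv_le (hδ : 0 ≤ δ) (hδ1 : δ ≤ 1) (x : Rn n) :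
    |morawetzProfileDeriv n δ x| ≤ 2 * bracketPow n (-3) x := by
  rw [abs_of_nonpos (morawetzProfileDeriv_nonpos hδ hδ1 x)]
  simp only [morawetzProfileDeriv]
  nlinarith [bracketPow_pos (-3 - δ) x]

theorem abs_morawetzProfileDeriv₂_le (hδ : 0 ≤ δ) (hδ1 : δ ≤ 1) (x : Rn n) :
    |morawetzProfileDeriv₂ n δ x| ≤ 8 * bracketPow n (-5) x := by
  have hle := bracketPow_mono (by linarith : -5 - δ ≤ -5) x
  have hpos := bracketPow_pos (-5 - δ) x
  have hcoeff : (1 + δ) * (3 + δ) ≤ 8 := by nlinarith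
  have hcoeff0 : 0 ≤ (1 + δ) * (3 + δ) := by positivity
  rw [abs_le]
  constructor <;> simp only [morawetzProfileDeriv₂] <;> nlinarith

theorem abs_mul_add_norm_sq_mul_le {g h a A B p : ℝ} {x : Rn n} (ha : 0 ≤ a)
    (hg : |g| ≤ A * bracketPow n p x) (hh : |h| ≤ B * bracketPow n (p - 2) x) :
    |a * g + ‖x‖ ^ 2 * h| ≤ (a * A + B) * bracketPow n p x := by
  have hB : 0 ≤ B := nonneg_of_mul_nonneg_left ((abs_nonneg _).trans hh) (bracketPow_pos _ _)
  calc |a * g + ‖x‖ ^ 2 * h| ≤ a * |g| + ‖x‖ ^ 2 * |h| := by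
        refine (abs_add_le _ _).trans_eq ?_
        rw [abs_mul, abs_mul, abs_of_nonneg ha, abs_of_nonneg (sq_nonneg ‖x‖)]
    _ ≤ a * (A * bracketPow n p x) + ‖x‖ ^ 2 * (B * bracketPow n (p - 2) x) := by gcongr
    _ = a * A * bracketPow n p x + B * (‖x‖ ^ 2 * bracketPow n (p - 2) x) := by ring
    _ ≤ a * A * bracketPow n p x + B * bracketPow n p x := by
        gcongr
        exact norm_sq_mul_bracketPow_le p x
    _ = (a * A + B) * bracketPow n p x := by ring

theorem abs_radialDivergence_morawetzProfile_le (hδ : 0 ≤ δ) (hδ1 : δ ≤ 1) (x : Rn n) :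
    |radialDivergence (morawetzProfile n δ) (morawetzProfileDeriv n δ) x| ≤ n * 2 + 2 := by
  refine (abs_mul_add_norm_sq_mul_le (B := 2) (p := -1) (Nat.cast_nonneg n)
    (abs_morawetzProfile_le hδ x)
    (by norm_num; exact abs_morawetzProfileDeriv_le hδ hδ1 x)).trans ?_
  have := bracketPow_mono (by norm_num : (-1 : ℝ) ≤ 0) x
  rw [bracketPow_zero] at this
  exact mul_le_of_le_one_right (by positivity) this

theorem le_morawetzProfile_add (hδ : 0 ≤ δ) (hδ1 : δ ≤ 1) (x : Rn n) :
    δ * bracketPow n (-1 - δ) x ≤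
      morawetzProfile n δ x + ‖x‖ ^ 2 * morawetzProfileDeriv n δ x := by
  have hsq := norm_sq_mul_bracketPow (-1) x
  have hsqδ := norm_sq_mul_bracketPow (-1 - δ) x
  have hle := bracketPow_mono (by linarith : -3 - δ ≤ -3) x
  have hpos := bracketPow_pos (-3 - δ) x
  rw [show (-1 : ℝ) - 2 = -3 by norm_num] at hsq
  rw [show -1 - δ - 2 = -3 - δ by ring] at hsqδ
  have expand : morawetzProfile n δ x + ‖x‖ ^ 2 * morawetzProfileDeriv n δ x =
      δ * bracketPow n (-1 - δ) x +
        (2 * bracketPow n (-3) x - (1 + δ) * bracketPow n (-3 - δ) x) := by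
    simp only [morawetzProfile, morawetzProfileDeriv]
    linear_combination (-2) * hsq + (1 + δ) * hsqδ
  rw [expand]
  nlinarith

end ProfileBounds

theorem morawetz_estimate {σ : ℝ} (hσ : 1 / 2 ≤ σ) (hσ1 : σ ≤ 1) (ζ : ℂ) (u : 𝓢(Rn n, ℂ)) :
    2 * ((2 * σ - 1) * weightedGradNorm (-σ) u ^ 2) ≤
      (4 * weightedGradNorm (-σ) u + (n * 2 + 2) * weightedNorm (-σ) u) *
        weightedNorm σ (schwartzSchrodinger n ζ u) +
      ((n + 2) * 2 + 8) * weightedNorm (-σ) u * weightedGradNorm (-σ) u +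
      |ζ.im| * ((4 * weightedGradNorm 0 u + (n * 2 + 2) * weightedNorm 0 u) *
        weightedNorm 0 u) := by
  set δ := 2 * σ - 1
  have hδ : 0 ≤ δ := by linarith
  have hδ1 : δ ≤ 1 := by linarith
  have hg := hasRadialDeriv_morawetzProfile (n := n) δ
  have hh := hasRadialDeriv_morawetzProfileDeriv (n := n) δ
  have hM := norm_inner_radialMultiplier_le hg.1 hg.2 (abs_morawetzProfile_le hδ)
    (abs_radialDivergence_morawetzProfile_le hδ hδ1)
  have source_term := (Complex.abs_re_le_norm _).trans (hM σ u (schwartzSchrodinger n ζ u))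
  have im_term := (Complex.abs_im_le_norm _).trans (hM 0 u u)
  have weight_term := (Complex.abs_re_le_norm _).trans <| norm_inner_schwartzMul_le
    (p := -σ) (q := σ - 3) (hasRadialDeriv_radialDivergence hg hh).2 (fun x ↦ by
      rw [show -σ + (σ - 3) = -3 by ring]
      refine abs_mul_add_norm_sq_mul_le (B := 8) (by positivity)
        (abs_morawetzProfileDeriv_le hδ hδ1 x) ?_
      norm_num
      exact abs_morawetzProfileDeriv₂_le hδ hδ1 x) u (euler n u)
  have euler_le : weightedNorm (σ - 3) (euler n u) ≤ weightedGradNorm (-σ) u :=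
    (weightedNorm_euler_le _ u).trans (weightedGradNorm_mono (by linarith) u)
  have coercive := sum_re_inner_schwartzMul_partialDeriv_le hg.1 hg.2
    (w := fun x ↦ δ * bracketPow n (-1 - δ) x) (by fun_prop)
    (morawetzProfileDeriv_nonpos hδ hδ1) (le_morawetzProfile_add hδ hδ1) u
  simp only [re_inner_schwartzMul_self, (by fun_prop :
    (fun x : Rn n ↦ δ * bracketPow n (-1 - δ) x).HasTemperateGrowth)] at coercive
  have lhs_eq : ∑ i, ∫ x, δ * bracketPow n (-1 - δ) x * ‖partialDeriv i u x‖ ^ 2 =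
      δ * weightedGradNorm (-σ) u ^ 2 := by
    simp only [weightedGradNorm_sq, weightedNorm_sq, Finset.mul_sum, ← integral_const_mul,
      mul_assoc, show 2 * -σ = -1 - δ by linarith]
  rw [lhs_eq] at coercive
  have identity := hg.re_inner_radialMultiplier_schwartzSchrodinger hh ζ u
  rw [neg_zero] at im_term
  have im_term' := mul_le_mul_of_nonneg_left im_term (abs_nonneg ζ.im)
  rw [← abs_mul] at im_term'
  have weight_term' := weight_term.trans (mul_le_mul_of_nonneg_left euler_le (by positivity))
  have source_le := (le_abs_self _).trans source_term
  have weight_le := (neg_abs_le _).trans' (neg_le_neg weight_term')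
  have im_le := (neg_abs_le _).trans' (neg_le_neg im_term')
  linarith

section HighEnergy

variable {σ : ℝ} (ζ : ℂ) (u : 𝓢(Rn n, ℂ))

theorem norm_mul_weightedNorm_sq_le (hσ : 0 ≤ σ) :
    ‖ζ‖ * weightedNorm (-σ) u ^ 2 ≤ weightedGradNorm (-σ) u ^ 2 +
      2 * σ * (weightedNorm (-σ) u * weightedGradNorm (-σ) u) +
        weightedNorm (-σ) u * weightedNorm (-σ) (schwartzSchrodinger n ζ u) := by
  have energy := norm_weighted_energy_le hσ ζ u
  rw [norm_sub_rev] at energy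
  have := (norm_sub_norm_le _ _).trans energy
  rw [norm_mul, Complex.norm_of_nonneg (sq_nonneg _), Complex.norm_of_nonneg (sq_nonneg _)] at this
  linarith

theorem weightedGradNorm_sq_le (hσ : 0 ≤ σ) :
    weightedGradNorm (-σ) u ^ 2 ≤ ‖ζ‖ * weightedNorm (-σ) u ^ 2 +
      2 * σ * (weightedNorm (-σ) u * weightedGradNorm (-σ) u) +
        weightedNorm (-σ) u * weightedNorm (-σ) (schwartzSchrodinger n ζ u) := by
  have := (norm_sub_norm_le _ _).trans (norm_weighted_energy_le hσ ζ u)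
  rw [norm_mul, Complex.norm_of_nonneg (sq_nonneg _), Complex.norm_of_nonneg (sq_nonneg _)] at this
  linarith

theorem inner_schwartzSchrodinger_self :
    ⟪u, schwartzSchrodinger n ζ u⟫ =
      (weightedGradNorm 0 u ^ 2 : ℝ) - ζ * (weightedNorm 0 u ^ 2 : ℝ) := by
  simp only [inner_schwartzSchrodinger, inner_self_eq_weightedNorm_zero_sq, weightedGradNorm_sq,
    Complex.ofReal_sum]

theorem abs_im_mul_weightedNorm_zero_sq_le (σ : ℝ) :
    |ζ.im| * weightedNorm 0 u ^ 2 ≤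
      weightedNorm (-σ) u * weightedNorm σ (schwartzSchrodinger n ζ u) := by
  have := (Complex.abs_im_le_norm _).trans
    (norm_inner_le_weightedNorm σ u (schwartzSchrodinger n ζ u))
  rwa [inner_schwartzSchrodinger_self, Complex.sub_im, Complex.ofReal_im, Complex.im_mul_ofReal,
    zero_sub, abs_neg, abs_mul, abs_of_nonneg (sq_nonneg (weightedNorm 0 u))] at this

theorem weightedGradNorm_zero_sq_le (σ : ℝ) :
    weightedGradNorm 0 u ^ 2 ≤ ‖ζ‖ * weightedNorm 0 u ^ 2 +
      weightedNorm (-σ) u * weightedNorm σ (schwartzSchrodinger n ζ u) := by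
  have := (le_abs_self _).trans <| (Complex.abs_re_le_norm _).trans
    (norm_inner_le_weightedNorm σ u (schwartzSchrodinger n ζ u))
  rw [inner_schwartzSchrodinger_self, Complex.sub_re, Complex.ofReal_re,
    Complex.re_mul_ofReal] at this
  have re_le := mul_le_mul_of_nonneg_right (Complex.re_le_norm ζ) (sq_nonneg (weightedNorm 0 u))
  linarith

theorem abs_im_mul_weightedGradNorm_zero_mul_le (σ : ℝ) :
    |ζ.im| * (weightedGradNorm 0 u * weightedNorm 0 u) ≤
      2 * √‖ζ‖ * (weightedNorm (-σ) u * weightedNorm σ (schwartzSchrodinger n ζ u)) := by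
  have hU := abs_im_mul_weightedNorm_zero_sq_le ζ u σ
  have hG := weightedGradNorm_zero_sq_le ζ u σ
  have hε := Complex.abs_im_le_norm ζ
  set S := weightedNorm (-σ) u * weightedNorm σ (schwartzSchrodinger n ζ u)
  set U := weightedNorm 0 u
  set G := weightedGradNorm 0 u
  have : 0 ≤ S := by positivity
  refine le_of_sq_le_sq ?_ (by positivity)
  calc (|ζ.im| * (G * U)) ^ 2 = |ζ.im| * (|ζ.im| * U ^ 2) * G ^ 2 := by ring
    _ ≤ |ζ.im| * (|ζ.im| * U ^ 2) * (‖ζ‖ * U ^ 2 + S) := by gcongr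
    _ = ‖ζ‖ * (|ζ.im| * U ^ 2) ^ 2 + |ζ.im| * ((|ζ.im| * U ^ 2) * S) := by ring
    _ ≤ ‖ζ‖ * S ^ 2 + ‖ζ‖ * (S * S) := by gcongr
    _ ≤ 4 * ‖ζ‖ * S ^ 2 := by nlinarith [mul_nonneg (norm_nonneg ζ) (sq_nonneg S)]
    _ = (2 * √‖ζ‖ * S) ^ 2 := by rw [mul_pow _ S, mul_pow 2, Real.sq_sqrt (norm_nonneg ζ)]; ring

variable {ζ}

theorem sqrt_norm_mul_weightedNorm_le (hσ : 0 ≤ σ) (hζ : 1 ≤ √‖ζ‖) (hζσ : 4 * σ ≤ √‖ζ‖) :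
    √‖ζ‖ * weightedNorm (-σ) u ≤
      2 * (weightedGradNorm (-σ) u + weightedNorm σ (schwartzSchrodinger n ζ u)) := by
  have energy := norm_mul_weightedNorm_sq_le ζ u hσ
  have hf := weightedNorm_mono (by linarith : -σ ≤ σ) (schwartzSchrodinger n ζ u)
  have hY := weightedGradNorm_nonneg (-σ) u
  have hf0 := apply_nonneg (weightedNorm σ) (schwartzSchrodinger n ζ u)
  have hX := apply_nonneg (weightedNorm (-σ)) u
  rw [← Real.sq_sqrt (norm_nonneg ζ)] at energy
  generalize weightedGradNorm (-σ) u = Y at *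
  generalize weightedNorm (-σ) u = X at *
  generalize weightedNorm σ (schwartzSchrodinger n ζ u) = f at *
  generalize √‖ζ‖ = t at *
  by_contra! h
  have weight_term : 2 * σ * (X * Y) ≤ t * X * Y / 2 := by
    have := mul_le_mul_of_nonneg_right hζσ (mul_nonneg hX hY)
    linarith
  have source_term : X * weightedNorm (-σ) (schwartzSchrodinger n ζ u) ≤ t * X * f :=
    mul_le_mul (le_mul_of_one_le_left hX hζ) hf (apply_nonneg _ _) (by positivity)
  nlinarith

end HighEnergy

theorem le_of_mul_sq_le_mul_add {a A y f : ℝ} (ha : 0 < a) (haA : a ≤ A) (hf : 0 ≤ f)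
    (h : a * y ^ 2 ≤ A * (f * (y + f))) : y ≤ 2 * (A / a) * f := by
  rw [mul_div_assoc', div_mul_eq_mul_div, le_div_iff₀ ha]
  by_contra! hlt
  have f_lt : 2 * f < y := by nlinarith
  nlinarith [mul_nonneg (mul_nonneg (ha.le.trans haA) hf) (by linarith : 0 ≤ y - 2 * f)]

/-- The limiting absorption estimate at high energy on Schwartz functions. The Morawetz estimate
controls the gradient up to a term of relative size `|ζ|^{-1/2}`, which is absorbed. -/
theorem high_energy_estimate (n : ℕ) {σ : ℝ} (hσ : 1 / 2 < σ) (hσ1 : σ ≤ 1) :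
    ∃ C, ∀ᶠ ζ in Bornology.cobounded ℂ, ∀ u : 𝓢(Rn n, ℂ),
      √‖ζ‖ * weightedNorm (-σ) u ≤ C * weightedNorm σ (schwartzSchrodinger n ζ u) ∧
      weightedGradNorm (-σ) u ≤ C * weightedNorm σ (schwartzSchrodinger n ζ u) := by
  set δ := 2 * σ - 1 with δ_def
  have hδ : 0 < δ := by linarith
  set A := 8 * n + 28 + δ with A_def
  have hδA : δ ≤ A := le_add_of_nonneg_left (by positivity)
  have large := (Real.tendsto_sqrt_atTop.comp
    (tendsto_norm_cobounded_atTop (E := ℂ))).eventually_ge_atTop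
  refine ⟨4 * (A / δ) + 2, ?_⟩
  filter_upwards [large 1, large (4 * σ), large (2 * ((n + 2) * 2 + 8) / δ)] with ζ ht htσ htδ u
  simp only [Function.comp_apply] at ht htσ htδ
  have morawetz := morawetz_estimate hσ.le hσ1 ζ u
  have hU := abs_im_mul_weightedNorm_zero_sq_le ζ u σ
  have hGU := abs_im_mul_weightedGradNorm_zero_mul_le ζ u σ
  have htX := sqrt_norm_mul_weightedNorm_le u (by linarith) ht htσ
  have hY := weightedGradNorm_nonneg (-σ) u
  have hf := apply_nonneg (weightedNorm σ) (schwartzSchrodinger n ζ u)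
  have hX := apply_nonneg (weightedNorm (-σ)) u
  rw [← δ_def] at morawetz
  rw [div_le_iff₀ hδ] at htδ
  generalize weightedGradNorm (-σ) u = Y at *
  generalize weightedNorm (-σ) u = X at *
  generalize weightedNorm σ (schwartzSchrodinger n ζ u) = f at *
  generalize √‖ζ‖ = t at *
  have htXf : t * X * f ≤ 2 * (Y + f) * f := by gcongr
  have hXf : X * f ≤ 2 * (Y + f) * f :=
    (mul_le_mul_of_nonneg_right (le_mul_of_one_le_left hX ht) hf).trans htXf
  have hXY : ((n + 2) * 2 + 8) * X * Y ≤ δ * (Y + f) * Y := by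
    have absorb := mul_le_mul_of_nonneg_right htδ (mul_nonneg hX hY)
    have bound := mul_le_mul_of_nonneg_left htX (mul_nonneg hδ.le hY)
    linarith
  have hXf' := mul_le_mul_of_nonneg_left hXf (by positivity : (0 : ℝ) ≤ n * 2 + 2)
  have hU' := mul_le_mul_of_nonneg_left hU (by positivity : (0 : ℝ) ≤ n * 2 + 2)
  have gradient_bound : Y ≤ 2 * (A / δ) * f :=
    le_of_mul_sq_le_mul_add hδ hδA hf (by
      rw [A_def]
      linarith [mul_nonneg hf hf, mul_nonneg hδ.le (mul_nonneg hf hf), mul_nonneg hf hY])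
  have : 0 ≤ A / δ * f := by positivity
  constructor <;> linarith

/-- The resolvent `(-Δ - ζ)⁻¹` on Schwartz functions. -/
def schwartzResolvent (n : ℕ) (ζ : ℂ) : 𝓢(Rn n, ℂ) →L[ℂ] 𝓢(Rn n, ℂ) :=
  SchwartzMap.fourierMultiplierCLM ℂ (fun ξ : Rn n ↦ (((2 * π) ^ 2 * ‖ξ‖ ^ 2 : ℝ) - ζ : ℂ)⁻¹)

theorem laplacian_eq_sum_partialDeriv (u : 𝓢(Rn n, ℂ)) :
    Laplacian.laplacian u = ∑ i, partialDeriv i (partialDeriv i u) := by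
  simp [SchwartzMap.laplacian_eq_sum (EuclideanSpace.basisFun (Fin n) ℝ), partialDeriv]

theorem schwartzSchrodinger_eq_fourierMultiplierCLM (ζ : ℂ) :
    schwartzSchrodinger n ζ = SchwartzMap.fourierMultiplierCLM ℂ
      (fun ξ : Rn n ↦ (((2 * π) ^ 2 * ‖ξ‖ ^ 2 : ℝ) - ζ : ℂ)) := by
  have symbol_eq : (fun ξ : Rn n ↦ (((2 * π) ^ 2 * ‖ξ‖ ^ 2 : ℝ) - ζ : ℂ)) =
      ((((2 * π) ^ 2 : ℝ) : ℂ) • fun ξ : Rn n ↦ ((‖ξ‖ ^ 2 : ℝ) : ℂ)) - fun _ ↦ ζ := by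
    ext ξ
    simp
  ext1 u
  rw [schwartzSchrodinger_apply, ← laplacian_eq_sum_partialDeriv,
    SchwartzMap.laplacian_eq_fourierMultiplierCLM,
    ← SchwartzMap.fourierMultiplierCLM_ofReal ℂ (by fun_prop), symbol_eq]
  simp only [SchwartzMap.fourierMultiplierCLM_apply]
  rw [SchwartzMap.smulLeftCLM_sub (by fun_prop) (by fun_prop),
    SchwartzMap.smulLeftCLM_smul (by fun_prop), sub_apply, SchwartzMap.smulLeftCLM_const]
  simp only [smul_apply, ContinuousLinearMap.id_apply]
  rw [sub_eq_add_neg (_ • _), ← neg_smul ζ, FourierTransform.fourierInv_add,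
    FourierTransform.fourierInv_smul, FourierTransform.fourierInv_smul,
    FourierTransform.fourierInv_fourier_eq, neg_smul, neg_neg, neg_smul, ← sub_eq_add_neg,
    Complex.coe_smul]
  rfl

theorem symbol_ne_zero {ζ : ℂ} (hζ : ζ ∈ slit) (ξ : Rn n) :
    (((2 * π) ^ 2 * ‖ξ‖ ^ 2 : ℝ) - ζ : ℂ) ≠ 0 := by
  obtain ⟨d, hd, hdist⟩ := exists_le_norm_sub hζ
  exact norm_pos_iff.mp (hd.trans (hdist _ (by positivity)))

section Resolvent

variable {ζ : ℂ} (hζ : ζ ∈ slit)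
include hζ

theorem schwartzSchrodinger_mul_schwartzResolvent :
    schwartzSchrodinger n ζ * schwartzResolvent n ζ = 1 := by
  rw [ContinuousLinearMap.mul_def, schwartzSchrodinger_eq_fourierMultiplierCLM, schwartzResolvent,
    SchwartzMap.fourierMultiplierCLM_compL_fourierMultiplierCLM (by fun_prop)
      (hasTemperateGrowth_inv_symbol n hζ),
    show ((fun ξ : Rn n ↦ (((2 * π) ^ 2 * ‖ξ‖ ^ 2 : ℝ) - ζ : ℂ)) *
      fun ξ : Rn n ↦ (((2 * π) ^ 2 * ‖ξ‖ ^ 2 : ℝ) - ζ : ℂ)⁻¹) = fun _ ↦ (1 : ℂ) from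
      funext fun ξ ↦ mul_inv_cancel₀ (symbol_ne_zero hζ ξ),
    SchwartzMap.fourierMultiplierCLM_const, one_smul]
  rfl

theorem schwartzResolvent_mul_schwartzSchrodinger :
    schwartzResolvent n ζ * schwartzSchrodinger n ζ = 1 := by
  rw [ContinuousLinearMap.mul_def, schwartzSchrodinger_eq_fourierMultiplierCLM, schwartzResolvent,
    SchwartzMap.fourierMultiplierCLM_compL_fourierMultiplierCLM
      (hasTemperateGrowth_inv_symbol n hζ) (by fun_prop),
    show ((fun ξ : Rn n ↦ (((2 * π) ^ 2 * ‖ξ‖ ^ 2 : ℝ) - ζ : ℂ)⁻¹) *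
      fun ξ : Rn n ↦ (((2 * π) ^ 2 * ‖ξ‖ ^ 2 : ℝ) - ζ : ℂ)) = fun _ ↦ (1 : ℂ) from
      funext fun ξ ↦ inv_mul_cancel₀ (symbol_ne_zero hζ ξ),
    SchwartzMap.fourierMultiplierCLM_const, one_smul]
  rfl

theorem schwartzSchrodinger_schwartzResolvent_pow_succ (j : ℕ) (u : 𝓢(Rn n, ℂ)) :
    schwartzSchrodinger n ζ ((schwartzResolvent n ζ ^ (j + 1)) u) =
      (schwartzResolvent n ζ ^ j) u := by
  rw [pow_succ', ← mul_apply_eq_comp, ← mul_assoc,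
    schwartzSchrodinger_mul_schwartzResolvent hζ, one_mul]

omit hζ in
theorem commute_schwartzSchrodinger_partialDeriv (i : Fin n) :
    Commute (schwartzSchrodinger n ζ) (partialDeriv i) := by
  ext1 u
  simp only [mul_apply_eq_comp, schwartzSchrodinger_apply, map_sub, map_neg, map_sum, map_smul,
    partialDeriv_comm i]

theorem commute_schwartzResolvent_partialDeriv (i : Fin n) :
    Commute (schwartzResolvent n ζ) (partialDeriv i) := by
  let P : (𝓢(Rn n, ℂ) →L[ℂ] 𝓢(Rn n, ℂ))ˣ :=
    ⟨schwartzSchrodinger n ζ, schwartzResolvent n ζ, schwartzSchrodinger_mul_schwartzResolvent hζ,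
      schwartzResolvent_mul_schwartzSchrodinger hζ⟩
  exact Commute.units_inv_left (u := P) (commute_schwartzSchrodinger_partialDeriv i)

omit hζ in
theorem schwartzSchrodinger_mul_euler :
    schwartzSchrodinger n ζ * euler n =
      euler n * schwartzSchrodinger n ζ + (2 : ℂ) • schwartzSchrodinger n ζ + (2 * ζ) • 1 := by
  ext1 u
  simp only [mul_apply_eq_comp, add_apply, smul_apply, one_apply_eq_self,
    schwartzSchrodinger_apply, partialDeriv_euler, map_add, map_sub, map_neg, map_sum, map_smul,
    Finset.sum_add_distrib]
  module

theorem euler_mul_schwartzResolvent :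
    euler n * schwartzResolvent n ζ = schwartzResolvent n ζ * euler n +
      (2 : ℂ) • schwartzResolvent n ζ + (2 * ζ) • schwartzResolvent n ζ ^ 2 := by
  have right_inv := schwartzSchrodinger_mul_schwartzResolvent (n := n) hζ
  have left_inv := schwartzResolvent_mul_schwartzSchrodinger (n := n) hζ
  have conj := congrArg (fun A ↦ schwartzResolvent n ζ * A * schwartzResolvent n ζ)
    (schwartzSchrodinger_mul_euler (n := n) (ζ := ζ))
  simp only [mul_add, add_mul, mul_smul_comm, smul_mul_assoc, mul_one] at conj
  rwa [← mul_assoc, left_inv, one_mul, mul_assoc (schwartzResolvent n ζ), mul_assoc (euler n),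
    right_inv, mul_one, one_mul, ← sq] at conj

theorem euler_mul_schwartzResolvent_pow (j : ℕ) :
    euler n * schwartzResolvent n ζ ^ j = schwartzResolvent n ζ ^ j * euler n +
      (2 * j : ℂ) • schwartzResolvent n ζ ^ j +
        (2 * j * ζ) • schwartzResolvent n ζ ^ (j + 1) := by
  induction j with
  | zero => simp
  | succ j ih =>
    rw [pow_succ (schwartzResolvent n ζ) j, ← mul_assoc, ih]
    simp only [add_mul, smul_mul_assoc]
    rw [mul_assoc _ (euler n), euler_mul_schwartzResolvent hζ]
    simp only [mul_add, mul_smul_comm, ← pow_succ, ← pow_add, ← mul_assoc]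
    push_cast
    module

theorem schwartzResolvent_pow_partialDeriv (j : ℕ) (i : Fin n) (u : 𝓢(Rn n, ℂ)) :
    (schwartzResolvent n ζ ^ j) (partialDeriv i u) =
      partialDeriv i ((schwartzResolvent n ζ ^ j) u) :=
  DFunLike.congr_fun ((commute_schwartzResolvent_partialDeriv hζ i).pow_left j).eq u

omit hζ in
theorem weightedNorm_coord_mul_le (p : ℝ) (i : Fin n) (u : 𝓢(Rn n, ℂ)) :
    weightedNorm p (schwartzMul (fun x ↦ x i) u) ≤ weightedNorm (p + 1) u := by
  have abs_coord_le (x : Rn n) : |x i| ≤ 1 * bracketPow n (p + 1 - p) x := by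
    refine (EuclideanSpace.norm_eq x ▸ Real.abs_le_sqrt ?_ : |x i| ≤ ‖x‖).trans ?_
    · simpa using Finset.single_le_sum (f := fun i ↦ ‖x i‖ ^ 2)
        (fun _ _ ↦ sq_nonneg _) (Finset.mem_univ i)
    · rw [add_sub_cancel_left, one_mul, bracketPow, ← Real.sqrt_eq_rpow]
      exact Real.le_sqrt_of_sq_le (by linarith)
  simpa using weightedNorm_schwartzMul_le (C := 1) (by fun_prop) abs_coord_le u

/-- Writing the Euler field as `∑ᵢ ∂ᵢxᵢ - n` and commuting `∂ᵢ` with the resolvent, one weight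
pays for its unbounded coefficients. -/
theorem weightedNorm_schwartzResolvent_pow_euler_le {σ M : ℝ} {j : ℕ} (hM : 0 ≤ M)
    (hnorm : ∀ u : 𝓢(Rn n, ℂ),
      weightedNorm (1 - σ) ((schwartzResolvent n ζ ^ j) u) ≤ M * weightedNorm (σ - 1) u)
    (hgrad : ∀ u : 𝓢(Rn n, ℂ),
      weightedGradNorm (1 - σ) ((schwartzResolvent n ζ ^ j) u) ≤ M * weightedNorm (σ - 1) u)
    (u : 𝓢(Rn n, ℂ)) :
    weightedNorm (-σ) ((schwartzResolvent n ζ ^ j) (euler n u)) ≤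
      2 * n * (M * weightedNorm σ u) := by
  have divergence_term (i : Fin n) :
      weightedNorm (-σ) (partialDeriv i ((schwartzResolvent n ζ ^ j)
        (schwartzMul (fun x ↦ x i) u))) ≤ M * weightedNorm σ u := by
    calc _ ≤ weightedGradNorm (1 - σ)
          ((schwartzResolvent n ζ ^ j) (schwartzMul (fun x ↦ x i) u)) :=
          (weightedNorm_mono (by linarith) _).trans (weightedNorm_partialDeriv_le _ i _)
      _ ≤ M * weightedNorm (σ - 1) (schwartzMul (fun x ↦ x i) u) := hgrad _
      _ ≤ M * weightedNorm σ u := by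
          gcongr
          simpa using weightedNorm_coord_mul_le (σ - 1) i u
  have zeroth_order_term : weightedNorm (-σ) ((schwartzResolvent n ζ ^ j) u) ≤
      M * weightedNorm σ u := by
    refine (weightedNorm_mono (by linarith) _).trans ((hnorm u).trans ?_)
    gcongr
    exact weightedNorm_mono (by linarith) u
  rw [← add_sub_cancel_left ((n : ℂ) • u) (euler n u), ← sum_partialDeriv_coord_mul, map_sub,
    map_sum, map_smul]
  simp only [schwartzResolvent_pow_partialDeriv hζ]
  refine (map_sub_le_add _ _ _).trans ?_
  rw [map_smul_eq_mul, Complex.norm_natCast]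
  calc _ ≤ ∑ _i : Fin n, M * weightedNorm σ u + n * (M * weightedNorm σ u) := by
        gcongr
        refine (Finset.le_sum_of_subadditive _ (map_zero _).le (map_add_le_add _) _ _).trans ?_
        exact Finset.sum_le_sum fun i _ ↦ divergence_term i
    _ = 2 * n * (M * weightedNorm σ u) := by
        rw [Finset.sum_const, Finset.card_univ, Fintype.card_fin, nsmul_eq_mul]
        ring

/-- The commutator identity `2jζ R^{j+1} = [E, R^j] - 2j R^j` with the Euler field `E` trades one
weight for one more power of the resolvent. -/
theorem norm_mul_weightedNorm_schwartzResolvent_pow_succ_le {σ M : ℝ} {j : ℕ} (hj : 1 ≤ j)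
    (hM : 0 ≤ M)
    (hnorm : ∀ u : 𝓢(Rn n, ℂ),
      weightedNorm (1 - σ) ((schwartzResolvent n ζ ^ j) u) ≤ M * weightedNorm (σ - 1) u)
    (hgrad : ∀ u : 𝓢(Rn n, ℂ),
      weightedGradNorm (1 - σ) ((schwartzResolvent n ζ ^ j) u) ≤ M * weightedNorm (σ - 1) u)
    (u : 𝓢(Rn n, ℂ)) :
    ‖ζ‖ * weightedNorm (-σ) ((schwartzResolvent n ζ ^ (j + 1)) u) ≤
      (n + 2) * (M * weightedNorm σ u) := by
  have hMu : M * weightedNorm (σ - 1) u ≤ M * weightedNorm σ u :=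
    mul_le_mul_of_nonneg_left (weightedNorm_mono (by linarith) u) hM
  have euler_outside : weightedNorm (-σ) (euler n ((schwartzResolvent n ζ ^ j) u)) ≤
      M * weightedNorm σ u := by
    refine (weightedNorm_euler_le _ _).trans ?_
    rw [neg_add_eq_sub]
    exact (hgrad u).trans hMu
  have euler_inside := weightedNorm_schwartzResolvent_pow_euler_le hζ hM hnorm hgrad u
  have lower_power : weightedNorm (-σ) ((schwartzResolvent n ζ ^ j) u) ≤ M * weightedNorm σ u :=
    (weightedNorm_mono (by linarith) _).trans ((hnorm u).trans hMu)
  have commutator : (2 * j * ζ : ℂ) • (schwartzResolvent n ζ ^ (j + 1)) u =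
      euler n ((schwartzResolvent n ζ ^ j) u) - (schwartzResolvent n ζ ^ j) (euler n u) -
        (2 * j : ℂ) • (schwartzResolvent n ζ ^ j) u := by
    have := DFunLike.congr_fun (euler_mul_schwartzResolvent_pow (n := n) hζ j) u
    simp only [mul_apply_eq_comp, add_apply, smul_apply] at this
    rw [this]
    abel
  have norm_coeff : ‖(2 * j : ℂ)‖ = 2 * j := by simp
  have triangle := congrArg (weightedNorm (-σ)) commutator |>.trans_le (map_sub_le_add _ _ _)
  rw [map_smul_eq_mul, map_smul_eq_mul, norm_mul, norm_coeff] at triangle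
  replace triangle := triangle.trans (add_le_add_left (map_sub_le_add _ _ _) _)
  have hj' : (1 : ℝ) ≤ j := mod_cast hj
  refine le_of_mul_le_mul_left ?_ (by positivity : (0 : ℝ) < 2 * j)
  nlinarith [mul_nonneg hM (apply_nonneg (weightedNorm σ) u),
    mul_nonneg (Nat.cast_nonneg (α := ℝ) n) (mul_nonneg hM (apply_nonneg (weightedNorm σ) u))]

omit hζ in
theorem weightedGradNorm_le {σ : ℝ} (hσ : 0 ≤ σ) (hζ : 1 ≤ √‖ζ‖) (u : 𝓢(Rn n, ℂ)) :
    weightedGradNorm (-σ) u ≤ (√‖ζ‖ + 2 * σ) * weightedNorm (-σ) u +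
      weightedNorm (-σ) (schwartzSchrodinger n ζ u) := by
  have energy := weightedGradNorm_sq_le ζ u hσ
  rw [← Real.sq_sqrt (norm_nonneg ζ)] at energy
  have hX := apply_nonneg (weightedNorm (-σ)) u
  have hV := apply_nonneg (weightedNorm (-σ)) (schwartzSchrodinger n ζ u)
  generalize weightedGradNorm (-σ) u = Y at *
  generalize weightedNorm (-σ) u = X at *
  generalize weightedNorm (-σ) (schwartzSchrodinger n ζ u) = V at *
  have hXt : X ≤ √‖ζ‖ * X := le_mul_of_one_le_left hX hζ
  have hσX : 0 ≤ σ * X := by positivity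
  by_contra! hlt
  have hY : √‖ζ‖ * X ≤ Y := by linarith
  nlinarith [mul_le_mul_of_nonneg_right hlt.le (by linarith : 0 ≤ Y),
    mul_le_mul_of_nonneg_left hY (hX.trans hXt), mul_le_mul_of_nonneg_left (hXt.trans hY) hV]

theorem schwartzResolvent_pow_succ_bounds {σ C : ℝ} {j : ℕ} (hσ : 0 ≤ σ) (hC : 0 ≤ C)
    (ht : 1 ≤ √‖ζ‖)
    (h : ∀ u : 𝓢(Rn n, ℂ),
      √‖ζ‖ ^ (j + 1) * weightedNorm (1 - σ) ((schwartzResolvent n ζ ^ (j + 1)) u) ≤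
        C * weightedNorm (σ - 1) u ∧
      √‖ζ‖ ^ j * weightedGradNorm (1 - σ) ((schwartzResolvent n ζ ^ (j + 1)) u) ≤
        C * weightedNorm (σ - 1) u)
    (u : 𝓢(Rn n, ℂ)) :
    √‖ζ‖ ^ (j + 2) * weightedNorm (-σ) ((schwartzResolvent n ζ ^ (j + 2)) u) ≤
      (n + 2) * C * weightedNorm σ u ∧
    √‖ζ‖ ^ (j + 1) * weightedGradNorm (-σ) ((schwartzResolvent n ζ ^ (j + 2)) u) ≤
      ((1 + 2 * σ) * ((n + 2) * C) + C) * weightedNorm σ u := by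
  have gradient := weightedGradNorm_le hσ ht ((schwartzResolvent n ζ ^ (j + 2)) u)
  rw [schwartzSchrodinger_schwartzResolvent_pow_succ hζ] at gradient
  have gain := norm_mul_weightedNorm_schwartzResolvent_pow_succ_le (M := C / √‖ζ‖ ^ j) hζ
    (Nat.le_add_left 1 j) (by positivity)
    (fun v ↦ by
      rw [div_mul_eq_mul_div, le_div_iff₀' (by positivity)]
      refine le_trans ?_ (h v).1
      exact mul_le_mul_of_nonneg_right (pow_le_pow_right₀ ht j.le_succ) (apply_nonneg _ _))
    (fun v ↦ by
      rw [div_mul_eq_mul_div, le_div_iff₀' (by positivity)]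
      exact (h v).2) u
  have lower_power : √‖ζ‖ ^ (j + 1) * weightedNorm (-σ) ((schwartzResolvent n ζ ^ (j + 1)) u) ≤
      C * weightedNorm σ u :=
    (mul_le_mul_of_nonneg_left (weightedNorm_mono (by linarith) _) (by positivity)).trans
      ((h u).1.trans (mul_le_mul_of_nonneg_left (weightedNorm_mono (by linarith) u) hC))
  have norm_bound : √‖ζ‖ ^ (j + 2) * weightedNorm (-σ) ((schwartzResolvent n ζ ^ (j + 2)) u) ≤
      (n + 2) * C * weightedNorm σ u := by
    rw [div_mul_eq_mul_div, mul_div_assoc', le_div_iff₀ (by positivity)] at gain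
    rw [pow_add, Real.sq_sqrt (norm_nonneg ζ)]
    linear_combination gain
  have norm_bound' := (mul_le_mul_of_nonneg_right (pow_le_pow_right₀ ht (j + 1).le_succ)
    (apply_nonneg _ _)).trans norm_bound
  refine ⟨norm_bound, ?_⟩
  linear_combination √‖ζ‖ ^ (j + 1) * gradient + norm_bound + 2 * σ * norm_bound' + lower_power

end Resolvent

theorem schwartzResolvent_pow_estimate (n j : ℕ) {σ : ℝ} (hσ : j + 1 / 2 < σ) :
    ∃ C, 0 ≤ C ∧ ∀ᶠ ζ in Bornology.cobounded ℂ ⊓ 𝓟 slit, ∀ u : 𝓢(Rn n, ℂ),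
      √‖ζ‖ ^ (j + 1) * weightedNorm (-σ) ((schwartzResolvent n ζ ^ (j + 1)) u) ≤
        C * weightedNorm σ u ∧
      √‖ζ‖ ^ j * weightedGradNorm (-σ) ((schwartzResolvent n ζ ^ (j + 1)) u) ≤
        C * weightedNorm σ u := by
  have large : ∀ᶠ ζ : ℂ in Bornology.cobounded ℂ ⊓ 𝓟 slit, 1 ≤ √‖ζ‖ :=
    ((Real.tendsto_sqrt_atTop.comp tendsto_norm_cobounded_atTop).mono_left
      inf_le_left).eventually_ge_atTop 1
  have mem_slit : ∀ᶠ ζ : ℂ in Bornology.cobounded ℂ ⊓ 𝓟 slit, ζ ∈ slit :=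
    eventually_inf_principal.2 (.of_forall fun _ h ↦ h)
  induction j generalizing σ with
  | zero =>
    obtain ⟨C, hC⟩ := high_energy_estimate n (σ := min σ 1)
      (lt_min (by simpa using hσ) (by norm_num)) (min_le_right _ _)
    refine ⟨|C|, abs_nonneg C, ?_⟩
    filter_upwards [hC.filter_mono inf_le_left, mem_slit] with ζ h hζ u
    have hu := h ((schwartzResolvent n ζ ^ 1) u)
    rw [schwartzSchrodinger_schwartzResolvent_pow_succ hζ, pow_zero, one_apply_eq_self] at hu
    have le_bound : C * weightedNorm (min σ 1) u ≤ |C| * weightedNorm σ u :=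
      mul_le_mul (le_abs_self C) (weightedNorm_mono (min_le_left _ _) u) (apply_nonneg _ _)
        (abs_nonneg C)
    rw [zero_add, pow_one (√‖ζ‖), pow_zero, one_mul]
    have hσ' : -σ ≤ -min σ 1 := neg_le_neg (min_le_left _ _)
    exact ⟨(mul_le_mul_of_nonneg_left (weightedNorm_mono hσ' _) (Real.sqrt_nonneg _)).trans
      (hu.1.trans le_bound), (weightedGradNorm_mono hσ' _).trans (hu.2.trans le_bound)⟩
  | succ j ih =>
    push_cast at hσ
    have hσ0 : 0 ≤ σ := by linarith [Nat.cast_nonneg (α := ℝ) j]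
    obtain ⟨C, hC0, hC⟩ := ih (σ := σ - 1) (by linarith)
    refine ⟨(1 + 2 * σ) * ((n + 2) * C) + C, by positivity, ?_⟩
    filter_upwards [hC, large, mem_slit] with ζ h ht hζ u
    simp only [neg_sub] at h
    have bounds := schwartzResolvent_pow_succ_bounds hζ hσ0 hC0 ht h u
    refine ⟨bounds.1.trans ?_, bounds.2⟩
    gcongr
    nlinarith [mul_nonneg hσ0 (by positivity : 0 ≤ (n + 2) * C)]

/-- The Hilbert space `L²(ℝⁿ)`. -/
abbrev L2Rn (n : ℕ) : Type := Lp ℂ 2 (volume : Measure (Rn n))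

/-- The action of the bounded continuous functions on `L²(ℝⁿ)` by multiplication. -/
def mulL2 (n : ℕ) : (Rn n →ᵇ ℂ) →L[ℂ] L2Rn n →L[ℂ] L2Rn n :=
  (ContinuousLinearMap.mul ℂ ℂ).holderL volume ⊤ 2 2 ∘L
    LinearMap.mkContinuous
      { toFun := fun m ↦ (m.memLp_top.toLp m : Lp ℂ ⊤ (volume : Measure (Rn n)))
        map_add' := fun _ _ ↦ rfl
        map_smul' := fun _ _ ↦ rfl } 1 fun m ↦ by
      rw [one_mul]
      refine (Lp.norm_toLp (⇑m) m.memLp_top).trans_le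
        (ENNReal.toReal_le_of_le_ofReal (norm_nonneg m) ?_)
      exact eLpNorm_exponent_top.trans_le
        (eLpNormEssSup_le_of_ae_bound (.of_forall m.norm_coe_le_norm))

theorem coeFn_mulL2 (m : Rn n →ᵇ ℂ) (f : L2Rn n) :
    mulL2 n m f =ᵐ[volume] fun x ↦ m x * f x := by
  filter_upwards [ContinuousLinearMap.coeFn_holder (r := 2) (ContinuousLinearMap.mul ℂ ℂ)
      (m.memLp_top.toLp m : Lp ℂ ⊤ (volume : Measure (Rn n))) f,
    (m.memLp_top (μ := (volume : Measure (Rn n)))).coeFn_toLp] with x hprod hm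
  exact hprod.trans (by rw [hm]; rfl)

theorem norm_mulL2_le (m : Rn n →ᵇ ℂ) : ‖mulL2 n m‖ ≤ ‖m‖ := by
  refine ContinuousLinearMap.opNorm_le_bound _ (norm_nonneg _) fun f ↦ ?_
  refine Lp.norm_le_mul_norm_of_ae_le_mul ?_
  filter_upwards [coeFn_mulL2 m f] with x hx
  rw [hx, norm_mul]
  gcongr
  exact m.norm_coe_le_norm x

theorem mulL2_schwartzToL2 {m : Rn n →ᵇ ℂ} (hm : (m : Rn n → ℂ).HasTemperateGrowth)
    (u : 𝓢(Rn n, ℂ)) :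
    mulL2 n m (schwartzToL2 n u) = schwartzToL2 n (SchwartzMap.smulLeftCLM ℂ m u) := by
  refine Lp.ext ?_
  filter_upwards [coeFn_mulL2 m (schwartzToL2 n u), u.coeFn_toLp 2 volume,
    (SchwartzMap.smulLeftCLM ℂ m u).coeFn_toLp 2 volume] with x hprod hu hmu
  refine hprod.trans (Eq.trans ?_ hmu.symm)
  rw [SchwartzMap.smulLeftCLM_apply_apply hm, smul_eq_mul]
  exact congrArg _ hu

theorem toTemperedDistribution_mulL2 {m : Rn n →ᵇ ℂ} (hm : (m : Rn n → ℂ).HasTemperateGrowth)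
    (f : L2Rn n) :
    Lp.toTemperedDistributionCLM ℂ volume 2 (mulL2 n m f) =
      TemperedDistribution.smulLeftCLM ℂ m (Lp.toTemperedDistributionCLM ℂ volume 2 f) :=
  Lp.toTemperedDistribution_smul_eq hm m.memLp_top f

/-- The Fourier multiplier on `L²(ℝⁿ)` with a bounded continuous symbol. -/
def fourierMulL2 (n : ℕ) : (Rn n →ᵇ ℂ) →L[ℂ] L2Rn n →L[ℂ] L2Rn n :=
  ((Lp.fourierTransformₗᵢ (Rn n) ℂ).symm.toContinuousLinearEquiv : L2Rn n →L[ℂ] L2Rn n).postcomp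
      (L2Rn n) ∘L
    ((Lp.fourierTransformₗᵢ (Rn n) ℂ).toContinuousLinearEquiv : L2Rn n →L[ℂ] L2Rn n).precomp
      (L2Rn n) ∘L mulL2 n

theorem fourierMulL2_apply (m : Rn n →ᵇ ℂ) (f : L2Rn n) :
    fourierMulL2 n m f = 𝓕⁻ (mulL2 n m (𝓕 f)) := rfl

theorem norm_fourierMulL2_le (m : Rn n →ᵇ ℂ) : ‖fourierMulL2 n m‖ ≤ ‖m‖ := by
  refine ContinuousLinearMap.opNorm_le_bound _ (norm_nonneg _) fun f ↦ ?_
  calc ‖fourierMulL2 n m f‖ = ‖mulL2 n m (𝓕 f)‖ :=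
        (Lp.fourierTransformₗᵢ (Rn n) ℂ).symm.norm_map _
    _ ≤ ‖m‖ * ‖𝓕 f‖ := (mulL2 n m).le_of_opNorm_le (norm_mulL2_le m) _
    _ = ‖m‖ * ‖f‖ := by rw [Lp.norm_fourier_eq]

theorem fourierMulL2_schwartzToL2 {m : Rn n →ᵇ ℂ} (hm : (m : Rn n → ℂ).HasTemperateGrowth)
    (u : 𝓢(Rn n, ℂ)) :
    fourierMulL2 n m (schwartzToL2 n u) =
      schwartzToL2 n (SchwartzMap.fourierMultiplierCLM ℂ m u) := by
  have fourier_toL2 : 𝓕 (schwartzToL2 n u) = schwartzToL2 n (𝓕 u) := SchwartzMap.toLp_fourier_eq u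
  rw [fourierMulL2_apply, fourier_toL2, mulL2_schwartzToL2 hm]
  exact SchwartzMap.toLp_fourierInv_eq _

theorem toTemperedDistribution_fourierMulL2 {m : Rn n →ᵇ ℂ}
    (hm : (m : Rn n → ℂ).HasTemperateGrowth) (f : L2Rn n) :
    Lp.toTemperedDistributionCLM ℂ volume 2 (fourierMulL2 n m f) =
      TemperedDistribution.fourierMultiplierCLM ℂ m
        (Lp.toTemperedDistributionCLM ℂ volume 2 f) := by
  have fourier_toTempered : 𝓕 (Lp.toTemperedDistributionCLM ℂ volume 2 f) =
      Lp.toTemperedDistributionCLM ℂ volume 2 (𝓕 f) := Lp.fourier_toTemperedDistribution_eq f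
  rw [TemperedDistribution.fourierMultiplierCLM_apply, fourier_toTempered,
    ← toTemperedDistribution_mulL2 hm]
  exact (Lp.fourierInv_toTemperedDistribution_eq _).symm

/-- The weight `⟨x⟩^{-σ}`, `σ ≥ 0`, as a bounded continuous function. -/
def boundedBracketPow (n : ℕ) {σ : ℝ} (hσ : 0 ≤ σ) : Rn n →ᵇ ℂ :=
  BoundedContinuousFunction.ofNormedAddCommGroup (fun x ↦ ((bracketPow n (-σ) x : ℝ) : ℂ))
    (Complex.continuous_ofReal.comp (hasTemperateGrowth_bracketPow (-σ)).1.continuous) 1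
    fun x ↦ by
      rw [Complex.norm_real, Real.norm_of_nonneg (bracketPow_pos _ x).le, ← bracketPow_zero x]
      exact bracketPow_mono (by linarith) x

section Sandwich

variable {σ : ℝ} (hσ : 0 ≤ σ)

theorem hasTemperateGrowth_boundedBracketPow :
    (boundedBracketPow n hσ : Rn n → ℂ).HasTemperateGrowth := by
  change (fun x ↦ ((bracketPow n (-σ) x : ℝ) : ℂ)).HasTemperateGrowth
  fun_prop

theorem norm_mulL2_boundedBracketPow_le (f : L2Rn n) :
    ‖mulL2 n (boundedBracketPow n hσ) f‖ ≤ ‖f‖ := by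
  refine (ContinuousLinearMap.le_of_opNorm_le _ ((norm_mulL2_le _).trans ?_) f).trans_eq
    (one_mul _)
  exact BoundedContinuousFunction.norm_ofNormedAddCommGroup_le _ zero_le_one _

theorem mulL2_boundedBracketPow_schwartzToL2 (u : 𝓢(Rn n, ℂ)) :
    mulL2 n (boundedBracketPow n hσ) (schwartzToL2 n u) =
      schwartzToL2 n (schwartzMul (bracketPow n (-σ)) u) :=
  mulL2_schwartzToL2 (hasTemperateGrowth_boundedBracketPow hσ) u

variable (n) in
/-- The operator `⟨x⟩^{-σ} m(D) ⟨x⟩^{-σ}` on `L²(ℝⁿ)`, where `m(D)` is the Fourier multiplier with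
symbol `m`. -/
def weightedFourierMul : (Rn n →ᵇ ℂ) →L[ℂ] L2Rn n →L[ℂ] L2Rn n :=
  (mulL2 n (boundedBracketPow n hσ)).postcomp (L2Rn n) ∘L
    (mulL2 n (boundedBracketPow n hσ)).precomp (L2Rn n) ∘L fourierMulL2 n

theorem weightedFourierMul_apply (m : Rn n →ᵇ ℂ) (f : L2Rn n) :
    weightedFourierMul n hσ m f = mulL2 n (boundedBracketPow n hσ)
      (fourierMulL2 n m (mulL2 n (boundedBracketPow n hσ) f)) := rfl

theorem norm_weightedFourierMul_le (m : Rn n →ᵇ ℂ) : ‖weightedFourierMul n hσ m‖ ≤ ‖m‖ := by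
  refine ContinuousLinearMap.opNorm_le_bound _ (norm_nonneg _) fun f ↦ ?_
  rw [weightedFourierMul_apply]
  refine (norm_mulL2_boundedBracketPow_le hσ _).trans ?_
  refine (ContinuousLinearMap.le_of_opNorm_le _ (norm_fourierMulL2_le m) _).trans ?_
  gcongr
  exact norm_mulL2_boundedBracketPow_le hσ f

theorem norm_weightedFourierMul_le_of_weightedNorm_le {m : Rn n →ᵇ ℂ}
    (hm : (m : Rn n → ℂ).HasTemperateGrowth) {C : ℝ} (hC : 0 ≤ C)
    (h : ∀ u, weightedNorm (-σ) (SchwartzMap.fourierMultiplierCLM ℂ m u) ≤ C * weightedNorm σ u) :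
    ‖weightedFourierMul n hσ m‖ ≤ C := by
  refine ContinuousLinearMap.opNorm_le_bound _ hC fun f ↦ ?_
  refine DenseRange.induction_on (p := fun f ↦ ‖weightedFourierMul n hσ m f‖ ≤ C * ‖f‖)
    (SchwartzMap.denseRange_toLpCLM (F := ℂ) (p := 2) (μ := (volume : Measure (Rn n)))
      ENNReal.ofNat_ne_top) f (isClosed_le (by fun_prop) (by fun_prop)) fun u ↦ ?_
  change ‖weightedFourierMul n hσ m (schwartzToL2 n u)‖ ≤ C * ‖schwartzToL2 n u‖
  rw [weightedFourierMul_apply, mulL2_boundedBracketPow_schwartzToL2,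
    fourierMulL2_schwartzToL2 hm, mulL2_boundedBracketPow_schwartzToL2, ← weightedNorm_apply]
  refine (h _).trans_eq ?_
  rw [weightedNorm_apply, schwartzMul_bracketPow_bracketPow, add_neg_cancel,
    schwartzMul_bracketPow_zero]

end Sandwich

section ResolventIdentity

variable {𝕜 A V : Type*} [NontriviallyNormedField 𝕜] [NormedRing A] [CompleteSpace A]
  [NormedAlgebra 𝕜 A] [NormedAddCommGroup V] [NormedSpace 𝕜 V]

/-- The family `f` satisfies the first resolvent identity on `U` with respect to the family `g`.
With `f = g` this says that `g` is a pseudo-resolvent; in general `f` is to be thought of as `g`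
times a constant. -/
def ResolventIdentityOn (U : Set 𝕜) (g f : 𝕜 → A) : Prop :=
  ∀ ζ ∈ U, ∀ ζ' ∈ U, f ζ' - f ζ = (ζ' - ζ) • (g ζ' * f ζ)

namespace ResolventIdentityOn

variable {U : Set 𝕜} {g f : 𝕜 → A} {ζ : 𝕜}

theorem continuousAt (hg : ResolventIdentityOn U g g) (hU : U ∈ 𝓝 ζ) : ContinuousAt g ζ := by
  have hζ : ζ ∈ U := mem_of_mem_nhds hU
  have tendsto_one : Tendsto (fun ζ' ↦ 1 - (ζ' - ζ) • g ζ) (𝓝 ζ) (𝓝 1) :=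
    Continuous.tendsto' (by fun_prop) _ _ (by simp)
  have eq_inverse : ∀ᶠ ζ' in 𝓝 ζ, g ζ * Ring.inverse (1 - (ζ' - ζ) • g ζ) = g ζ' := by
    filter_upwards [hU, tendsto_one (Units.nhds 1)] with ζ' hζ' hunit
    have factor : g ζ' * (1 - (ζ' - ζ) • g ζ) = g ζ := by
      rw [mul_sub, mul_one, mul_smul_comm, ← hg ζ hζ ζ' hζ', sub_sub_cancel]
    nth_rw 1 [← factor]
    rw [mul_assoc, Ring.mul_inverse_cancel _ hunit, mul_one]
  have tendsto_inverse := (NormedRing.inverse_continuousAt (1 : Aˣ)).tendsto.comp tendsto_one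
  rw [Units.val_one, Ring.inverse_one] at tendsto_inverse
  refine ContinuousAt.congr ?_ eq_inverse
  simpa [ContinuousAt] using tendsto_inverse.const_mul (g ζ)

theorem hasDerivAt (hg : ResolventIdentityOn U g g) (hf : ResolventIdentityOn U g f)
    (hU : U ∈ 𝓝 ζ) : HasDerivAt f (g ζ * f ζ) ζ := by
  rw [hasDerivAt_iff_tendsto_slope]
  refine Tendsto.congr' ?_
    (((hg.continuousAt hU).tendsto.mul_const (f ζ)).mono_left nhdsWithin_le_nhds)
  filter_upwards [self_mem_nhdsWithin, nhdsWithin_le_nhds hU] with ζ' hne hζ'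
  rw [slope_def_module, hf ζ (mem_of_mem_nhds hU) ζ' hζ', smul_smul,
    inv_mul_cancel₀ (sub_ne_zero.mpr hne), one_smul]

theorem hasDerivAt_pow_mul (hg : ResolventIdentityOn U g g) (hf : ResolventIdentityOn U g f)
    (hU : U ∈ 𝓝 ζ) (j : ℕ) :
    HasDerivAt (fun ζ ↦ g ζ ^ j * f ζ) ((j + 1 : 𝕜) • (g ζ ^ (j + 1) * f ζ)) ζ := by
  induction j with
  | zero => simpa using hg.hasDerivAt hf hU
  | succ j ih =>
    simp only [pow_succ' _ j, mul_assoc]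
    refine ((hg.hasDerivAt hg hU).mul ih).congr_deriv ?_
    rw [mul_smul_comm, mul_assoc (g ζ), ← mul_assoc (g ζ) (g ζ ^ j),
      ← mul_assoc (g ζ) (g ζ ^ (j + 1)),
      ← pow_succ', ← pow_succ', ← mul_assoc, ← pow_succ']
    push_cast
    module

theorem iteratedDeriv_clm_apply (hg : ResolventIdentityOn U g g) (hf : ResolventIdentityOn U g f)
    (hU : IsOpen U) (Ψ : A →L[𝕜] V) (k : ℕ) :
    ∀ ζ ∈ U, iteratedDeriv k (fun ζ ↦ Ψ (f ζ)) ζ = (k.factorial : 𝕜) • Ψ (g ζ ^ k * f ζ) := by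
  induction k with
  | zero => simp
  | succ k ih =>
    intro ζ hζ
    have hderiv := (Ψ.hasFDerivAt.comp_hasDerivAt ζ
      (hg.hasDerivAt_pow_mul hf (hU.mem_nhds hζ) k)).const_smul (k.factorial : 𝕜)
    rw [iteratedDeriv_succ, EventuallyEq.deriv_eq (eventually_of_mem (hU.mem_nhds hζ) ih)]
    refine hderiv.deriv.trans ?_
    rw [map_smul, smul_smul, Nat.factorial_succ]
    push_cast
    ring_nf

end ResolventIdentityOn

theorem ResolventIdentityOn.analyticOnNhd {A : Type*} [NormedRing A] [CompleteSpace A]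
    [NormedAlgebra ℂ A] {U : Set ℂ} {g f : ℂ → A} (hg : ResolventIdentityOn U g g)
    (hf : ResolventIdentityOn U g f) (hU : IsOpen U) : AnalyticOnNhd ℂ f U :=
  DifferentiableOn.analyticOnNhd (fun _ hζ ↦
    (hg.hasDerivAt hf (hU.mem_nhds hζ)).differentiableAt.differentiableWithinAt) hU

end ResolventIdentity

section Taylor

theorem exists_norm_one_add_cpow_sub_taylor_le (a : ℂ) (N : ℕ) :
    ∃ c : ℕ → ℂ, ∃ r C : ℝ, 0 < r ∧ r < 1 ∧ 0 ≤ C ∧ ∀ t : ℂ, ‖t‖ ≤ r →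
      ‖(1 + t) ^ a - ∑ i ∈ Finset.range N, c i * t ^ i‖ ≤ C * ‖t‖ ^ N := by
  have analytic : AnalyticAt ℂ (fun t : ℂ ↦ (1 + t) ^ a) 0 :=
    (analyticAt_const.add analyticAt_id).cpow analyticAt_const (by simp)
  obtain ⟨q, hq⟩ := analytic
  obtain ⟨C, hC, hbound⟩ := (hq.isBigO_sub_partialSum_pow N).exists_nonneg
  obtain ⟨ε, hε, hball⟩ := Metric.eventually_nhds_iff_ball.mp hbound.bound
  refine ⟨q.coeff, min ε 1 / 2, C, by positivity, ?_, hC, fun t ht ↦ ?_⟩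
  · linarith [min_le_right ε 1]
  · have hmem : t ∈ Metric.ball (0 : ℂ) ε := by
      rw [mem_ball_zero_iff]
      linarith [min_le_left ε 1, lt_min hε one_pos]
    simpa [FormalMultilinearSeries.partialSum, mul_comm] using hball t hmem

theorem ofReal_cpow_eq_cpow_mul_cpow_div {p : ℝ} (hp : 0 < p) {z : ℂ} (hz : z ∈ Complex.slitPlane)
    (a : ℂ) : (p : ℂ) ^ a = z ^ a * (p / z) ^ a := by
  have hz0 : z ≠ 0 := Complex.slitPlane_ne_zero hz
  have hp0 : (p : ℂ) ≠ 0 := by exact_mod_cast hp.ne'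
  rw [Complex.cpow_def_of_ne_zero hp0, Complex.cpow_def_of_ne_zero hz0,
    Complex.cpow_def_of_ne_zero (div_ne_zero hp0 hz0), div_eq_mul_inv,
    Complex.log_ofReal_mul hp (inv_ne_zero hz0),
    Complex.log_inv _ (Complex.mem_slitPlane_iff_arg.mp hz).1, Complex.ofReal_log hp.le,
    ← Complex.exp_add]
  ring_nf

theorem rpow_le_two_pow_mul_rpow {p x τ a : ℝ} {N : ℕ} (hp : 1 ≤ p) (hx : 1 ≤ x) (hτ : 1 ≤ τ)
    (hpx : p ≤ x * (2 * τ)) (ha₁ : -(N / 2) ≤ a) (ha₂ : a ≤ N) :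
    p ^ a ≤ 2 ^ N * x ^ (a + N / 2) * τ ^ N := by
  have : 0 < x := by linarith
  rcases le_total 0 a with ha | ha
  · calc p ^ a ≤ (x * (2 * τ)) ^ a := by gcongr
      _ = x ^ a * (2 * τ) ^ a := Real.mul_rpow (by positivity) (by positivity)
      _ ≤ x ^ (a + N / 2) * (2 * τ) ^ (N : ℝ) := by
        gcongr ?_ * ?_
        · exact Real.rpow_le_rpow_of_exponent_le hx (le_add_of_nonneg_right (by positivity))
        · exact Real.rpow_le_rpow_of_exponent_le (by linarith) ha₂
      _ = 2 ^ N * x ^ (a + N / 2) * τ ^ N := by rw [Real.rpow_natCast]; ring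
  · calc p ^ a ≤ 1 * 1 * 1 := by simpa using Real.rpow_le_one_of_one_le_of_nonpos hp ha
      _ ≤ 2 ^ N * x ^ (a + N / 2) * τ ^ N := by
        gcongr
        · exact one_le_pow₀ one_le_two
        · exact Real.one_le_rpow hx (by linarith)
        · exact one_le_pow₀ hτ

theorem mem_slitPlane_of_norm_sub_div_lt_one {p : ℝ} (hp : 0 < p) {z : ℂ} (hz : z ≠ 0)
    (h : ‖(p - z) / z‖ < 1) : z ∈ Complex.slitPlane := by
  rw [norm_div, div_lt_one (norm_pos_iff.mpr hz)] at h
  by_contra hmem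
  rw [Complex.mem_slitPlane_iff, not_or, not_lt, not_ne_iff] at hmem
  obtain ⟨hre, him⟩ := hmem
  refine h.not_ge ?_
  calc ‖z‖ = -z.re := by rw [← Complex.abs_re_eq_norm.mpr him, abs_of_nonpos hre]
    _ ≤ ((p : ℂ) - z).re := by rw [Complex.sub_re, Complex.ofReal_re]; linarith
    _ ≤ ‖p - z‖ := Complex.re_le_norm _

theorem norm_rpow_sub_taylor_le_of_le_norm {a r p : ℝ} {N : ℕ} (ha₁ : -(N / 2) ≤ a) (ha₂ : a ≤ N)
    (hr : 0 < r) (hr1 : r < 1) (hp : 1 ≤ p) {z : ℂ} (hz : 1 ≤ ‖z‖) (h : r ≤ ‖(p - z) / z‖)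
    (c : ℕ → ℂ) :
    ‖(p ^ a : ℝ) - z ^ (a : ℂ) * ∑ i ∈ Finset.range N, c i * ((p - z) / z) ^ i‖ ≤
      (2 ^ N + ∑ i ∈ Finset.range N, ‖c i‖) / r ^ N *
        (‖z‖ ^ (a + N / 2) * ‖(p - z) / z‖ ^ N) := by
  have hz0 : z ≠ 0 := norm_pos_iff.mp (by linarith)
  obtain ⟨t, ht⟩ : ∃ t, t = (p - z) / z := ⟨_, rfl⟩
  rw [← ht] at h ⊢
  have p_eq : (p : ℂ) = z * (1 + t) := by rw [ht]; field_simp; ring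
  have norm_t_le : ‖t‖ ≤ ‖t‖ / r := le_div_self (norm_nonneg t) hr hr1.le
  have one_le : 1 ≤ ‖t‖ / r := (one_le_div hr).mpr h
  have hpz : p ≤ ‖z‖ * (2 * (‖t‖ / r)) :=
    calc p = ‖z‖ * ‖1 + t‖ := by
          rw [← norm_mul, ← p_eq, Complex.norm_real, Real.norm_of_nonneg (by linarith)]
      _ ≤ ‖z‖ * (2 * (‖t‖ / r)) := by
        gcongr
        linarith [norm_add_le 1 t, norm_one (α := ℂ)]
  have term_le : ∀ i ∈ Finset.range N, ‖c i * t ^ i‖ ≤ ‖c i‖ * (‖t‖ / r) ^ N := fun i hi ↦ by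
    rw [norm_mul, norm_pow]
    gcongr
    exact (pow_le_pow_left₀ (norm_nonneg t) norm_t_le i).trans
      (pow_le_pow_right₀ one_le (Finset.mem_range.mp hi).le)
  calc _ ≤ ‖((p ^ a : ℝ) : ℂ)‖ + ‖z ^ (a : ℂ)‖ * ∑ i ∈ Finset.range N, ‖c i * t ^ i‖ := by
        refine (norm_sub_le _ _).trans ?_
        rw [norm_mul]
        gcongr
        exact norm_sum_le _ _
    _ ≤ 2 ^ N * ‖z‖ ^ (a + N / 2) * (‖t‖ / r) ^ N +
        ‖z‖ ^ (a + N / 2) * ∑ i ∈ Finset.range N, ‖c i‖ * (‖t‖ / r) ^ N := by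
      rw [Complex.norm_cpow_real, Complex.norm_real, Real.norm_of_nonneg (by positivity)]
      gcongr ?_ + ?_ * ?_
      · exact rpow_le_two_pow_mul_rpow hp hz one_le hpz ha₁ ha₂
      · exact Real.rpow_le_rpow_of_exponent_le hz (le_add_of_nonneg_right (by positivity))
      · exact Finset.sum_le_sum term_le
    _ = (2 ^ N + ∑ i ∈ Finset.range N, ‖c i‖) / r ^ N * (‖z‖ ^ (a + N / 2) * ‖t‖ ^ N) := by
      rw [← Finset.sum_mul, div_pow]
      ring

theorem exists_norm_rpow_sub_taylor_le {a : ℝ} {N : ℕ} (ha₁ : -(N / 2) ≤ a) (ha₂ : a ≤ N) :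
    ∃ c : ℕ → ℂ, ∃ C : ℝ, ∀ p : ℝ, 1 ≤ p → ∀ z : ℂ, 1 ≤ ‖z‖ →
      ‖(p ^ a : ℝ) - z ^ (a : ℂ) * ∑ i ∈ Finset.range N, c i * ((p - z) / z) ^ i‖ ≤
        C * (‖z‖ ^ (a + N / 2) * ‖(p - z) / z‖ ^ N) := by
  obtain ⟨c, r, C, hr, hr1, _, htaylor⟩ := exists_norm_one_add_cpow_sub_taylor_le a N
  refine ⟨c, max C ((2 ^ N + ∑ i ∈ Finset.range N, ‖c i‖) / r ^ N), fun p hp z hz ↦ ?_⟩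
  have hp0 : 0 < p := by linarith
  have hz0 : z ≠ 0 := norm_pos_iff.mp (by linarith)
  rcases le_total ‖(p - z) / z‖ r with small | large
  · have hslit := mem_slitPlane_of_norm_sub_div_lt_one hp0 hz0 (small.trans_lt hr1)
    have one_add : 1 + (p - z) / z = p / z := by field_simp; ring
    rw [Complex.ofReal_cpow hp0.le, ofReal_cpow_eq_cpow_mul_cpow_div hp0 hslit, ← one_add,
      ← mul_sub, norm_mul, Complex.norm_cpow_real, mul_left_comm]
    gcongr ?_ * ?_
    · exact Real.rpow_le_rpow_of_exponent_le hz (le_add_of_nonneg_right (by positivity))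
    · exact (htaylor _ small).trans (by gcongr; exact le_max_left _ _)
  · refine (norm_rpow_sub_taylor_le_of_le_norm ha₁ ha₂ hr hr1 hp hz large c).trans ?_
    gcongr
    exact le_max_right _ _

end Taylor

theorem isOpen_slit : IsOpen slit :=
  (Complex.isometry_ofReal.isClosedEmbedding.isClosedMap _ isClosed_Ici).isOpen_compl

theorem bracketPow_two_pi_smul_two (ξ : Rn n) :
    bracketPow n 2 ((2 * π) • ξ) = 1 + (2 * π) ^ 2 * ‖ξ‖ ^ 2 := by
  rw [bracketPow_two, norm_smul, mul_pow, Real.norm_eq_abs, sq_abs]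

theorem exists_norm_resolvent_symbol_le {l : ℝ} (hl : l ≤ 2) {ζ : ℂ} (hζ : ζ ∈ slit) :
    ∃ C, ∀ ξ : Rn n,
      ‖(bracketPow n l ((2 * π) • ξ) : ℂ) * (((2 * π) ^ 2 * ‖ξ‖ ^ 2 : ℝ) - ζ : ℂ)⁻¹‖ ≤ C := by
  obtain ⟨d, hd, hdist⟩ := exists_le_norm_sub hζ
  refine ⟨1 + ‖1 + ζ‖ / d, fun ξ ↦ ?_⟩
  have lt_norm := hdist _ (by positivity : 0 ≤ (2 * π) ^ 2 * ‖ξ‖ ^ 2)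
  have norm_pos : 0 < ‖(((2 * π) ^ 2 * ‖ξ‖ ^ 2 : ℝ) : ℂ) - ζ‖ := hd.trans lt_norm
  rw [norm_mul, norm_inv, Complex.norm_real, Real.norm_of_nonneg (bracketPow_pos _ _).le,
    ← div_eq_mul_inv, div_le_iff₀ norm_pos]
  calc bracketPow n l ((2 * π) • ξ)
      ≤ ‖(1 + (2 * π) ^ 2 * ‖ξ‖ ^ 2 : ℝ)‖ := by
        rw [← bracketPow_two_pi_smul_two, Real.norm_of_nonneg (bracketPow_pos _ _).le]
        exact bracketPow_mono hl _
    _ = ‖((((2 * π) ^ 2 * ‖ξ‖ ^ 2 : ℝ) : ℂ) - ζ) + (1 + ζ)‖ := by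
        rw [← Complex.norm_real]
        congr 1
        push_cast
        ring
    _ ≤ ‖(((2 * π) ^ 2 * ‖ξ‖ ^ 2 : ℝ) : ℂ) - ζ‖ + ‖1 + ζ‖ := norm_add_le _ _
    _ ≤ (1 + ‖1 + ζ‖ / d) * ‖(((2 * π) ^ 2 * ‖ξ‖ ^ 2 : ℝ) : ℂ) - ζ‖ := by
        rw [add_mul, one_mul, div_mul_eq_mul_div]
        gcongr
        rw [le_div_iff₀ hd]
        gcongr

open Classical in
/-- The symbol `⟨2πξ⟩^l / (|2πξ|² - ζ)` of `⟨∇⟩^l (-Δ - ζ)⁻¹` as a bounded continuous function, for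
`l ≤ 2` and `ζ` in the slit plane (and `0` otherwise). -/
def resolventSymbol (n : ℕ) (l : ℝ) (ζ : ℂ) : Rn n →ᵇ ℂ :=
  if h : l ≤ 2 ∧ ζ ∈ slit then
    BoundedContinuousFunction.ofNormedAddCommGroup
      (fun ξ ↦ (bracketPow n l ((2 * π) • ξ) : ℂ) * (((2 * π) ^ 2 * ‖ξ‖ ^ 2 : ℝ) - ζ : ℂ)⁻¹)
      ((hasTemperateGrowth_japanese n l).1.continuous.mul
        (hasTemperateGrowth_inv_symbol n h.2).1.continuous) _
      (exists_norm_resolvent_symbol_le h.1 h.2).choose_spec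
  else 0

section ResolventSymbol

variable {l : ℝ} {ζ : ℂ}

theorem coe_resolventSymbol (hl : l ≤ 2) (hζ : ζ ∈ slit) :
    (resolventSymbol n l ζ : Rn n → ℂ) =
      fun ξ ↦ (bracketPow n l ((2 * π) • ξ) : ℂ) * (((2 * π) ^ 2 * ‖ξ‖ ^ 2 : ℝ) - ζ : ℂ)⁻¹ := by
  rw [resolventSymbol, dif_pos ⟨hl, hζ⟩]
  rfl

theorem resolventSymbol_zero_apply (hζ : ζ ∈ slit) (ξ : Rn n) :
    resolventSymbol n 0 ζ ξ = (((2 * π) ^ 2 * ‖ξ‖ ^ 2 : ℝ) - ζ : ℂ)⁻¹ := by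
  simp only [coe_resolventSymbol zero_le_two hζ, bracketPow_zero, Complex.ofReal_one, one_mul]

theorem resolventIdentityOn_resolventSymbol (hl : l ≤ 2) :
    ResolventIdentityOn slit (resolventSymbol n 0) (resolventSymbol n l) := by
  intro ζ hζ ζ' hζ'
  ext ξ
  simp only [BoundedContinuousFunction.sub_apply, BoundedContinuousFunction.smul_apply,
    BoundedContinuousFunction.mul_apply, resolventSymbol_zero_apply hζ',
    coe_resolventSymbol hl hζ, coe_resolventSymbol hl hζ', smul_eq_mul]
  have hne := symbol_ne_zero hζ ξ
  have hne' := symbol_ne_zero hζ' ξ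
  generalize (((2 * π) ^ 2 * ‖ξ‖ ^ 2 : ℝ) : ℂ) = a at *
  field_simp
  ring

theorem hasTemperateGrowth_resolventSymbol (hl : l ≤ 2) (hζ : ζ ∈ slit) :
    (resolventSymbol n l ζ : Rn n → ℂ).HasTemperateGrowth := by
  rw [coe_resolventSymbol hl hζ]
  exact (hasTemperateGrowth_japanese n l).mul (hasTemperateGrowth_inv_symbol n hζ)

theorem hasTemperateGrowth_resolventSymbol_zero_pow (hζ : ζ ∈ slit) (j : ℕ) :
    (⇑(resolventSymbol n 0 ζ ^ j) : Rn n → ℂ).HasTemperateGrowth := by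
  have := hasTemperateGrowth_resolventSymbol (n := n) zero_le_two hζ
  rw [BoundedContinuousFunction.coe_pow]
  fun_prop

theorem fourierMultiplierCLM_resolventSymbol_zero_pow (hζ : ζ ∈ slit) (j : ℕ) :
    SchwartzMap.fourierMultiplierCLM ℂ ⇑(resolventSymbol n 0 ζ ^ j) =
      schwartzResolvent n ζ ^ j := by
  induction j with
  | zero =>
    rw [pow_zero, pow_zero]
    exact (SchwartzMap.fourierMultiplierCLM_const (1 : ℂ)).trans (one_smul ℂ _)
  | succ j ih =>
    rw [pow_succ (schwartzResolvent n ζ), ← ih, ContinuousLinearMap.mul_def, schwartzResolvent,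
      ← funext (resolventSymbol_zero_apply hζ),
      SchwartzMap.fourierMultiplierCLM_compL_fourierMultiplierCLM
        (hasTemperateGrowth_resolventSymbol_zero_pow hζ j)
        (hasTemperateGrowth_resolventSymbol zero_le_two hζ)]
    rfl

end ResolventSymbol

section SymbolHighEnergy

variable {k : ℕ} {l σ : ℝ}

theorem inv_pow_mul_sub_sum_eq {K : Type*} [Field K] {w : K} (hw : w ≠ 0) (z A B : K)
    (c : ℕ → K) (k : ℕ) :
    w⁻¹ ^ k * (A * w⁻¹) - ∑ i ∈ Finset.range (k + 1), c i * B / z ^ i * w⁻¹ ^ (k + 1 - i) =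
      w⁻¹ ^ (k + 1) * (A - B * ∑ i ∈ Finset.range (k + 1), c i * (w / z) ^ i) := by
  have term_eq : ∀ i ∈ Finset.range (k + 1), c i * B / z ^ i * w⁻¹ ^ (k + 1 - i) =
      w⁻¹ ^ (k + 1) * (B * (c i * (w / z) ^ i)) := fun i hi ↦ by
    rw [pow_sub₀ _ (inv_ne_zero hw) (Finset.mem_range.mp hi).le, inv_pow _ i, inv_inv, div_pow]
    ring
  rw [Finset.sum_congr rfl term_eq, ← Finset.mul_sum, ← Finset.mul_sum]
  ring

theorem exists_norm_resolventSymbol_pow_mul_sub_sum_le (n : ℕ) (hl₁ : -(k + 1 : ℝ) ≤ l)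
    (hl₂ : l ≤ 2) :
    ∃ c : ℕ → ℂ, ∃ C : ℝ, ∀ ζ ∈ slit, 1 ≤ ‖1 + ζ‖ →
      ‖resolventSymbol n 0 ζ ^ k * resolventSymbol n l ζ -
        ∑ i ∈ Finset.range (k + 1),
          (c i * (1 + ζ) ^ ((l / 2 : ℝ) : ℂ) / (1 + ζ) ^ i) •
            resolventSymbol n 0 ζ ^ (k + 1 - i)‖ ≤
        C * ‖1 + ζ‖ ^ (-((1 - l + k) / 2)) := by
  obtain ⟨c, C, h⟩ := exists_norm_rpow_sub_taylor_le (a := l / 2) (N := k + 1)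
    (by push_cast; linarith) (by push_cast; linarith [k.cast_nonneg (α := ℝ)])
  refine ⟨c, C, fun ζ hζ hz ↦
    BoundedContinuousFunction.norm_le_of_nonempty.mpr fun ξ ↦ ?_⟩
  obtain ⟨P, hP⟩ : ∃ P : ℝ, P = (2 * π) ^ 2 * ‖ξ‖ ^ 2 := ⟨_, rfl⟩
  have taylor := h (1 + P) (by rw [hP]; exact le_add_of_nonneg_right (by positivity)) (1 + ζ) hz
  have symbol_ne : (P : ℂ) - ζ ≠ 0 := hP ▸ symbol_ne_zero hζ ξ
  have norm_symbol_ne := norm_ne_zero_iff.mpr symbol_ne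
  have norm_ne : ‖1 + ζ‖ ≠ 0 := by linarith
  have sub_eq : ((1 + P : ℝ) : ℂ) - (1 + ζ) = P - ζ := by push_cast; ring
  have bracket_eq : bracketPow n l ((2 * π) • ξ) = (1 + P) ^ (l / 2) := by
    rw [bracketPow, norm_smul, mul_pow, Real.norm_eq_abs, sq_abs, hP]
  have exponent_eq : -((1 - l + k) / 2) = l / 2 + ((k + 1 : ℕ) : ℝ) / 2 - ((k + 1 : ℕ) : ℝ) := by
    push_cast; ring
  simp only [BoundedContinuousFunction.sub_apply, BoundedContinuousFunction.mul_apply,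
    BoundedContinuousFunction.pow_apply, BoundedContinuousFunction.sum_apply,
    BoundedContinuousFunction.smul_apply, resolventSymbol_zero_apply hζ,
    coe_resolventSymbol hl₂ hζ, ← hP, bracket_eq, smul_eq_mul]
  rw [inv_pow_mul_sub_sum_eq symbol_ne, norm_mul]
  rw [sub_eq] at taylor
  refine (mul_le_mul_of_nonneg_left taylor (norm_nonneg _)).trans_eq ?_
  rw [exponent_eq, Real.rpow_sub_natCast norm_ne, norm_pow, norm_inv, norm_div, inv_pow, div_pow]
  field_simp

/-- The neighbourhoods of infinity in the slit plane. -/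
def slitAtInfinity : Filter ℂ := Bornology.cobounded ℂ ⊓ 𝓟 slit

theorem eventually_mem_slit : ∀ᶠ ζ in slitAtInfinity, ζ ∈ slit :=
  (eventually_principal.mpr fun _ hζ ↦ hζ).filter_mono inf_le_right

theorem tendsto_norm_slitAtInfinity : Tendsto norm slitAtInfinity atTop :=
  tendsto_norm_cobounded_atTop.mono_left inf_le_left

theorem isTheta_norm_one_add :
    (fun ζ : ℂ ↦ ‖1 + ζ‖) =Θ[slitAtInfinity] fun ζ ↦ ‖ζ‖ :=
  have isTheta_cobounded := (Asymptotics.isLittleO_const_id_cobounded (1 : ℂ)).right_isTheta_add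
  isTheta_cobounded.symm.norm_left.norm_right.mono inf_le_left

theorem tendsto_norm_one_add : Tendsto (fun ζ : ℂ ↦ ‖1 + ζ‖) slitAtInfinity atTop := by
  simpa [Function.comp_def] using isTheta_norm_one_add.tendsto_norm_atTop_iff.mpr
    (by simpa [Function.comp_def] using tendsto_norm_slitAtInfinity)

theorem isTheta_norm_one_add_rpow (a : ℝ) :
    (fun ζ : ℂ ↦ ‖1 + ζ‖ ^ a) =Θ[slitAtInfinity] fun ζ ↦ ‖ζ‖ ^ a :=
  isTheta_norm_one_add.rpow (.of_forall fun _ ↦ norm_nonneg _) (.of_forall fun _ ↦ norm_nonneg _)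

theorem isBigO_const_mul_cpow_div_pow (c : ℂ) (a : ℝ) (i : ℕ) :
    (fun ζ : ℂ ↦ c * (1 + ζ) ^ (a : ℂ) / (1 + ζ) ^ i) =O[slitAtInfinity]
      fun ζ ↦ ‖ζ‖ ^ (a - i) := by
  refine Asymptotics.IsBigO.trans (.of_bound ‖c‖ ?_) (isTheta_norm_one_add_rpow (a - i)).isBigO
  filter_upwards [tendsto_norm_one_add.eventually_gt_atTop 0] with ζ hpos
  rw [norm_div, norm_mul, norm_pow, Complex.norm_cpow_real, Real.norm_of_nonneg (by positivity),
    Real.rpow_sub_natCast hpos.ne', mul_div_assoc]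

theorem isBigO_norm_rpow_mul_norm_rpow {a b d : ℝ} (h : a + b ≤ d) :
    (fun ζ : ℂ ↦ ‖ζ‖ ^ a * ‖ζ‖ ^ b) =O[slitAtInfinity] fun ζ ↦ ‖ζ‖ ^ d := by
  refine .of_bound 1 ?_
  filter_upwards [tendsto_norm_slitAtInfinity.eventually_ge_atTop 1] with ζ hζ
  rw [← Real.rpow_add (by linarith), Real.norm_of_nonneg (by positivity),
    Real.norm_of_nonneg (by positivity), one_mul]
  exact Real.rpow_le_rpow_of_exponent_le hζ h

theorem isBigO_weightedFourierMul_resolventSymbol_zero_pow (n : ℕ) (hσ : 0 ≤ σ) {j : ℕ}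
    (hj : 1 ≤ j) (hjσ : j < σ + 1 / 2) :
    (fun ζ ↦ weightedFourierMul n hσ (resolventSymbol n 0 ζ ^ j)) =O[slitAtInfinity]
      fun ζ ↦ ‖ζ‖ ^ (-(j / 2) : ℝ) := by
  obtain ⟨i, rfl⟩ := Nat.exists_eq_add_of_le' hj
  push_cast at hjσ
  obtain ⟨C, hC, h⟩ := schwartzResolvent_pow_estimate n i (σ := σ) (by linarith)
  refine .of_bound C ?_
  filter_upwards [h, eventually_mem_slit,
    tendsto_norm_slitAtInfinity.eventually_gt_atTop 0] with ζ hest hζ hpos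
  have sqrt_pow : ‖ζ‖ ^ (-((i + 1 : ℕ) / 2) : ℝ) = (√‖ζ‖ ^ (i + 1))⁻¹ := by
    rw [Real.sqrt_eq_rpow, ← Real.rpow_natCast, ← Real.rpow_mul (norm_nonneg _),
      ← Real.rpow_neg (norm_nonneg _)]
    ring_nf
  rw [sqrt_pow, Real.norm_of_nonneg (by positivity)]
  refine norm_weightedFourierMul_le_of_weightedNorm_le hσ
    (hasTemperateGrowth_resolventSymbol_zero_pow hζ _) (by positivity) fun u ↦ ?_
  rw [fourierMultiplierCLM_resolventSymbol_zero_pow hζ, mul_right_comm, ← div_eq_mul_inv,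
    le_div_iff₀ (by positivity), mul_comm]
  exact (hest u).1

theorem isBigO_weightedFourierMul_resolventSymbol (n : ℕ) (hσ : 0 ≤ σ) (hkσ : 1 / 2 + k < σ)
    (hl₁ : -(k + 1 : ℝ) ≤ l) (hl₂ : l ≤ 2) :
    (fun ζ ↦ weightedFourierMul n hσ (resolventSymbol n 0 ζ ^ k * resolventSymbol n l ζ))
      =O[slitAtInfinity] fun ζ ↦ ‖ζ‖ ^ (-((1 - l + k) / 2)) := by
  obtain ⟨c, C, hC⟩ := exists_norm_resolventSymbol_pow_mul_sub_sum_le n hl₁ hl₂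
  have remainder : (fun ζ ↦ weightedFourierMul n hσ
      (resolventSymbol n 0 ζ ^ k * resolventSymbol n l ζ - ∑ i ∈ Finset.range (k + 1),
        (c i * (1 + ζ) ^ ((l / 2 : ℝ) : ℂ) / (1 + ζ) ^ i) •
          resolventSymbol n 0 ζ ^ (k + 1 - i))) =O[slitAtInfinity]
      fun ζ ↦ ‖ζ‖ ^ (-((1 - l + k) / 2)) := by
    refine Asymptotics.IsBigO.trans (.of_bound C ?_)
      (isTheta_norm_one_add_rpow (-((1 - l + k) / 2))).isBigO
    filter_upwards [eventually_mem_slit, tendsto_norm_one_add.eventually_ge_atTop 1] with ζ hζ hz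
    rw [Real.norm_of_nonneg (by positivity)]
    exact (norm_weightedFourierMul_le hσ _).trans (hC ζ hζ hz)
  have main : ∀ i ∈ Finset.range (k + 1),
      (fun ζ ↦ (c i * (1 + ζ) ^ ((l / 2 : ℝ) : ℂ) / (1 + ζ) ^ i) •
        weightedFourierMul n hσ (resolventSymbol n 0 ζ ^ (k + 1 - i))) =O[slitAtInfinity]
      fun ζ ↦ ‖ζ‖ ^ (-((1 - l + k) / 2)) := fun i hi ↦ by
    have i_lt : i < k + 1 := Finset.mem_range.mp hi
    have i_cast : ((k + 1 - i : ℕ) : ℝ) = k + 1 - i := by push_cast [i_lt.le]; ring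
    refine ((isBigO_const_mul_cpow_div_pow (c i) (l / 2) i).smul
      (isBigO_weightedFourierMul_resolventSymbol_zero_pow n hσ (by lia) ?_)).trans
      (isBigO_norm_rpow_mul_norm_rpow ?_)
    · rw [i_cast]
      linarith [i.cast_nonneg (α := ℝ)]
    · rw [i_cast]
      linarith [i.cast_nonneg (α := ℝ)]
  refine (remainder.add (Asymptotics.IsBigO.sum main)).congr_left fun ζ ↦ ?_
  simp only [map_sub, map_sum, map_smul, Finset.sum_apply, sub_add_cancel]

end SymbolHighEnergy

section Transport

theorem toL2_surjective (n : ℕ) (s σ : ℝ) : Function.Surjective (toL2 n s σ) := by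
  intro f
  let ψ := japaneseNabla n (-s) (weight n (-σ) (Lp.toTemperedDistributionCLM ℂ volume 2 f))
  have toTempered_eq : Lp.toTemperedDistributionCLM ℂ volume 2 f =
      weight n σ (japaneseNabla n s ψ) := by
    have nabla_cancel := japaneseNabla_neg_japaneseNabla n (-s)
      (weight n (-σ) (Lp.toTemperedDistributionCLM ℂ volume 2 f))
    have weight_cancel := weight_neg_weight n (-σ) (Lp.toTemperedDistributionCLM ℂ volume 2 f)
    rw [neg_neg] at nabla_cancel weight_cancel
    rw [nabla_cancel, weight_cancel]
  let φ : H n s σ := (⟨ψ, mem_Hs_iff.mpr ⟨f, toTempered_eq⟩⟩ : Hs n s σ)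
  exact ⟨φ, toTempered_injective n ((toL2_spec φ).trans toTempered_eq.symm)⟩

/-- The isometry `ψ ↦ ⟨x⟩^σ ⟨∇⟩^s ψ` of `H^s_σ` onto `L²`. -/
def equivL2 (n : ℕ) (s σ : ℝ) : H n s σ ≃ₗᵢ[ℂ] L2Rn n where
  __ := LinearEquiv.ofBijective (toL2 n s σ) ⟨toL2_injective n s σ, toL2_surjective n s σ⟩
  norm_map' _ := rfl

/-- The operator between weighted Sobolev spaces which corresponds to a given operator on `L²`
under the isometries `equivL2`. -/
def transport (n : ℕ) (s σ s' σ' : ℝ) :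
    (L2Rn n →L[ℂ] L2Rn n) →L[ℂ] (H n s σ →L[ℂ] H n s' σ') :=
  ((equivL2 n s' σ').symm.toContinuousLinearEquiv : L2Rn n →L[ℂ] H n s' σ').postcomp (H n s σ) ∘L
    ((equivL2 n s σ).toContinuousLinearEquiv : H n s σ →L[ℂ] L2Rn n).precomp (L2Rn n)

theorem toL2_transport {s σ s' σ' : ℝ} (A : L2Rn n →L[ℂ] L2Rn n) (u : H n s σ) :
    toL2 n s' σ' (transport n s σ s' σ' A u) = A (toL2 n s σ u) :=
  (equivL2 n s' σ').apply_symm_apply _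

theorem freeResolvent_eq_fourierMultiplierCLM {ζ : ℂ} (hζ : ζ ∈ slit) :
    freeResolvent n ζ = TemperedDistribution.fourierMultiplierCLM ℂ (resolventSymbol n 0 ζ) := by
  ext1 u
  have mul_eq_one : ⇑(resolventSymbol n 0 ζ) *
      (fun ξ : Rn n ↦ (((2 * π) ^ 2 * ‖ξ‖ ^ 2 : ℝ) - ζ : ℂ)) = fun _ ↦ 1 := by
    ext ξ
    rw [Pi.mul_apply, resolventSymbol_zero_apply hζ, inv_mul_cancel₀ (symbol_ne_zero hζ ξ)]
  rw [← freeResolvent_schrodinger n hζ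
      (TemperedDistribution.fourierMultiplierCLM ℂ (resolventSymbol n 0 ζ) u),
    schrodinger_eq_fourierMultiplier,
    TemperedDistribution.fourierMultiplierCLM_fourierMultiplierCLM_apply
      (hasTemperateGrowth_resolventSymbol zero_le_two hζ) (by fun_prop), mul_eq_one,
    TemperedDistribution.fourierMultiplierCLM_const, one_smul]
  rfl

theorem japaneseNabla_freeResolvent {l : ℝ} (hl : l ≤ 2) {ζ : ℂ} (hζ : ζ ∈ slit) (s : ℝ)
    (u : 𝓢'(Rn n, ℂ)) :
    japaneseNabla n (s + l) (freeResolvent n ζ u) =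
      TemperedDistribution.fourierMultiplierCLM ℂ (resolventSymbol n l ζ)
        (japaneseNabla n s u) := by
  rw [freeResolvent_eq_fourierMultiplierCLM hζ, japaneseNabla, japaneseNabla,
    TemperedDistribution.fourierMultiplierCLM_fourierMultiplierCLM_apply
      (hasTemperateGrowth_resolventSymbol zero_le_two hζ) (hasTemperateGrowth_japanese n _),
    TemperedDistribution.fourierMultiplierCLM_fourierMultiplierCLM_apply
      (hasTemperateGrowth_japanese n _) (hasTemperateGrowth_resolventSymbol hl hζ)]
  congr 2
  ext ξ
  have bracket_add := congrArg Complex.ofReal (bracketPow_add s l ((2 * π) • ξ))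
  rw [Complex.ofReal_mul] at bracket_add
  rw [Pi.mul_apply, Pi.mul_apply, resolventSymbol_zero_apply hζ, coe_resolventSymbol hl hζ,
    ← mul_assoc]
  exact (mul_comm _ _).trans (congrArg (· * _) bracket_add)

theorem toDist_transport_weightedFourierMul {s σ l : ℝ} (hσ : 0 ≤ σ) (hl : l ≤ 2) {ζ : ℂ}
    (hζ : ζ ∈ slit) (u : H n s σ) :
    toDist n (s + l) (-σ)
        (transport n s σ (s + l) (-σ) (weightedFourierMul n hσ (resolventSymbol n l ζ)) u) =
      freeResolvent n ζ (toDist n s σ u) := by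
  have smulLeft_eq : TemperedDistribution.smulLeftCLM ℂ (boundedBracketPow n hσ) =
      weight n (-σ) := rfl
  have growth := hasTemperateGrowth_boundedBracketPow (n := n) hσ
  have spec := toL2_spec
    (transport n s σ (s + l) (-σ) (weightedFourierMul n hσ (resolventSymbol n l ζ)) u)
  rw [toL2_transport, weightedFourierMul_apply, toTemperedDistribution_mulL2 growth,
    toTemperedDistribution_fourierMulL2 (hasTemperateGrowth_resolventSymbol hl hζ),
    toTemperedDistribution_mulL2 growth, smulLeft_eq, toL2_spec, weight_neg_weight,
    ← japaneseNabla_freeResolvent hl hζ] at spec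
  have weight_injective : Function.Injective (weight n (-σ)) :=
    Function.LeftInverse.injective (weight_neg_weight n (-σ))
  have japaneseNabla_injective : Function.Injective (japaneseNabla n (s + l)) :=
    Function.LeftInverse.injective (japaneseNabla_neg_japaneseNabla n (s + l))
  exact (japaneseNabla_injective (weight_injective spec)).symm

end Transport

end WeightedSobolev

end

theorem propositionA1_general (n k : ℕ) (s σ l : ℝ) (hσ : 1 / 2 + (k : ℝ) < σ)
    (hl₁ : -(k + 1 : ℝ) ≤ l) (hl₂ : l ≤ 2) :
    ∃ R : ℂ → (WeightedSobolev.H n s σ →L[ℂ] WeightedSobolev.H n (s + l) (-σ)),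
      (∀ ζ ∈ WeightedSobolev.slit, ∀ u : WeightedSobolev.H n s σ,
        WeightedSobolev.toDist n (s + l) (-σ) (R ζ u) =
          WeightedSobolev.freeResolvent n ζ (WeightedSobolev.toDist n s σ u)) ∧
      AnalyticOnNhd ℂ R WeightedSobolev.slit ∧
      (fun ζ : ℂ ↦ ‖iteratedDeriv k R ζ‖)
        =O[Bornology.cobounded ℂ ⊓ 𝓟 WeightedSobolev.slit]
        (fun ζ : ℂ ↦ ‖ζ‖ ^ (-((1 - l + (k : ℝ)) / 2))) := by
  have hσ₀ : 0 ≤ σ := by linarith [k.cast_nonneg (α := ℝ)]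
  have identity_zero := WeightedSobolev.resolventIdentityOn_resolventSymbol (n := n) zero_le_two
  have identity := WeightedSobolev.resolventIdentityOn_resolventSymbol (n := n) hl₂
  let T := WeightedSobolev.transport n s σ (s + l) (-σ)
  let Ψ := T ∘L WeightedSobolev.weightedFourierMul n hσ₀
  refine ⟨fun ζ ↦ Ψ (WeightedSobolev.resolventSymbol n l ζ),
    fun ζ hζ ↦ WeightedSobolev.toDist_transport_weightedFourierMul hσ₀ hl₂ hζ,
    Ψ.comp_analyticOnNhd (identity_zero.analyticOnNhd identity WeightedSobolev.isOpen_slit), ?_⟩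
  have isBigO := ((T.isBigO_comp _ _).trans
    (WeightedSobolev.isBigO_weightedFourierMul_resolventSymbol n hσ₀ hσ hl₁ hl₂)).const_smul_left
      (k.factorial : ℂ)
  refine (isBigO.congr' ?_ .rfl).norm_left
  filter_upwards [WeightedSobolev.eventually_mem_slit] with ζ hζ
  exact (identity_zero.iteratedDeriv_clm_apply identity WeightedSobolev.isOpen_slit Ψ k ζ hζ).symm

theorem propositionA1 (n : ℕ) (hn : 1 ≤ n) (k : ℕ) (s σ : ℝ) (hσ : 1 / 2 + (k : ℝ) < σ) (l : ℤ)
    (hl : (k = 0 ∧ l ∈ ({-1, 0, 1, 2} : Set ℤ)) ∨ (1 ≤ k ∧ l ∈ ({-1, 0, 1} : Set ℤ))) :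
    ∃ R : ℂ → (WeightedSobolev.H n s σ →L[ℂ] WeightedSobolev.H n (s + (l : ℝ)) (-σ)),
      (∀ ζ ∈ WeightedSobolev.slit, ∀ u : WeightedSobolev.H n s σ,
        WeightedSobolev.toDist n (s + (l : ℝ)) (-σ) (R ζ u) =
          WeightedSobolev.freeResolvent n ζ (WeightedSobolev.toDist n s σ u)) ∧
      AnalyticOnNhd ℂ R WeightedSobolev.slit ∧
      (fun ζ : ℂ ↦ ‖iteratedDeriv k R ζ‖)
        =O[Bornology.cobounded ℂ ⊓ 𝓟 WeightedSobolev.slit]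
        (fun ζ : ℂ ↦ ‖ζ‖ ^ (-((1 - (l : ℝ) + (k : ℝ)) / 2))) := by
  have hl_bounds : -1 ≤ l ∧ l ≤ 2 := by
    simp only [Set.mem_insert_iff, Set.mem_singleton_iff] at hl
    lia
  have hl₁ : (-1 : ℝ) ≤ l := by exact_mod_cast hl_bounds.1
  exact propositionA1_general n k s σ l hσ (by linarith [k.cast_nonneg (α := ℝ)])
    (by exact_mod_cast hl_bounds.2)
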